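/- **Random graph.** Let $\beta>2$, $\lambda_{\mathrm{hub}},\lambda_{\mathrm{ldn}}\in(0,1)$, and for $n\to\infty$ let $m=m(n)>0$, $w=w(n)>0$, $\Delta=\Delta(n)\in\mathbb N_{\ge1}$, $\delta=\delta(n)\in\mathbb N$ satisfy $m\asymp n^{1/(\beta-1)}$, $w=o(n^{\lambda_{\mathrm{ldn}}/(\beta-1)})$, $\Delta\sim\lambda_{\mathrm{hub}}m$, $\delta\asymp m^{\lambda_{\mathrm{ldn}}}$. For $N\in\mathbb N$ let $G$ be a realization (almost every one) of the Chung–Lu random power-law graph on the nodes $1,\dots,N$: distinct nodes $i,j$ are linked independently with probability $\min\{1,w_iw_j/\sum_kw_k\}$, where, with $m=m(N)$, $w=w(N)$, $$w_i=\tfrac{\beta-2}{\beta-1}\,w\,N^{\frac1{\beta-1}}\Big[N\big(\tfrac{w(\beta-2)}{m(\beta-1)}\big)^{\beta-1}+i-1\Big]^{-\frac1{\beta-1}} .$$ Let $\Delta=\Delta(N)$, $\delta=\delta(N)$. Let $A$ be the adjacency matrix of $G$, $\mathcal N_i$ the set of neighbours and $k_i$ the degree of node $i$, $\Delta_0=\max_ik_i$,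 $\mathcal H_\Delta=\{i:k_i\ge\Delta\}$ the set of hubs, $M=\#\mathcal H_\Delta$, $\mathcal L_\delta=\{i:k_i\le\delta\}$ the set of low degree nodes, $\nu_i=\#(\mathcal N_i\cap\mathcal L_\delta)/k_i$. Suppose that $G$ is $(\Delta,\delta,\nu)$-locally star-like: $\nu_i\ge\nu$ for all $i\in\mathcal H_\Delta$. **Dynamics.** Let $\theta$ preserve the probability measure $\mathbb P$ on $\Omega$, $\mathbb T=\mathbb R/\mathbb Z$, and let $\varphi_i:\mathbb N\times\Omega\times\mathbb T\to\mathbb T$, $i=1,\dots,N$, be measurable cocycles over $\theta$. Assume: (R1) the random continuous maps $\varphi_i(1,\theta^t\omega,\cdot)$ are identically distributed and independent in $t\in\mathbb N$ and $i$; (R2) the isolated node dynamics have a unique stationary probability measure $m_0$, i.e. $\int\mathbb P(\varphi_i(1,\omega,x)\in B)\,dm_0(x)=m_0(B)$ for all Borel $B$; (R3) $h:\Omega\times\mathbb T^2\to\mathbb R$ is measurable, $h(\omega,\cdot,\cdot)\in C^4(\mathbb T^2;\mathbb R)$, and the $h(\theta^t\omega,\cdot,\cdot)$, $t\in\mathbb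 N$, are independent and identically distributed; and, for some $\lambda\in(0,1)$, $d_{\mathbb T}(\varphi_i(1,\omega,x),\varphi_i(1,\omega,y))\le\lambda\, d_{\mathbb T}(x,y)$ for all $i,\omega,x,y$. For $\alpha>0$ the network orbit of $(\omega,x)\in\Omega\times\mathbb T^N$ is $x^0=x$, $$x_i^{t+1}=\varphi_i(1,\theta^t\omega,x_i^t)+\frac{\alpha}{\Delta_0}\sum_{j}A_{ij}h(\theta^t\omega,x_i^t,x_j^t)\mod 1 .$$ For a hub $i$ put $\alpha_i=\alpha\nu_ik_i/\Delta_0$. The reduced system $\varphi_{\alpha_i,m_0}$ is $z^{t+1}=\varphi_i(1,\theta^t\omega,z^t)+\alpha_i\int h(\theta^t\omega,z^t,y)\,dm_0(y)\bmod 1$, and the fluctuation of hub $i$ about it is $\xi_i^t=\frac{\alpha}{\Delta_0}\sum_jA_{ij}h(\theta^t\omega,x_i^t,x_j^t)-\alpha_i\int h(\theta^t\omega,x_i^t,y)\,dm_0(y)$. Hub $i$ *admits $\eta$-reduction to $\varphi_{\alpha_i,m_0}$ with exceptional frequency at most $\rho$* if $\limsup_{T\to\infty}\frac1T\#\{0\le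 t<T:|\xi_i^t|>\eta\}\le\rho$. Write $\|h\|_{C^0}=\sup_t\|h(\theta^t\omega,\cdot,\cdot)\|_{C^0}$, $|h|_{\mathrm{Lip}}=\sup_t|h(\theta^t\omega,\cdot,\cdot)|_{\mathrm{Lip}}$ (for the maximum distance on $\mathbb T^2$), $\|h\|_{C^4}=\sup_t\|h(\theta^t\omega,\cdot,\cdot)\|_{C^4}$ (the largest sup norm of a partial derivative of order $\le4$). **Claim.** $m_0=\pi_*\mathbb P$ for the coding map $\pi(\omega)=\lim_n\varphi_i(1,\omega,\cdot)\circ\varphi_i(1,\theta\omega,\cdot)\circ\dots\circ\varphi_i(1,\theta^{n-1}\omega,p)$ of every node $i$. For $\mathbb P$-almost every $\omega$ with $\|h\|_{C^4}<\infty$ (otherwise the frequency bound below is infinite) and every $x\in\mathbb T^N$: 1. every low degree node $j$ is shadowed by its isolated orbit: $d_{\mathbb T}(x_j^t,\varphi_j(t,\omega,x_j))\le\frac{1}{1-\lambda}\,\alpha\Delta_0^{-1}\delta\,\|h\|_{C^0}$ for all $t\in\mathbb N$; 2. for every $$\varepsilon\ge\max\Big\{\alpha\Delta^{-1/2},\ 4\alpha^2\delta\Delta_0^{-1}(1-\lambda)^{-1}\|h\|_{C^0}|h|_{\mathrm{Lip}}\Big\}$$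 every hub $i\in\mathcal H_\Delta$ admits $(\varepsilon+\alpha(1-\nu)\|h\|_{C^0})$-reduction to $\varphi_{\alpha_i,m_0}$ with exceptional frequency at most $$4M\,D\,\exp\big(-\nu\Delta\,\varepsilon^2\alpha^{-2}c(\omega)\big),\qquad c(\omega)=\frac{450}{\|h\|_{C^4}^2},\qquad c_1\,\frac{\alpha\|h\|_{C^4}}{\varepsilon}\le D\le c_2\,\frac{\alpha\|h\|_{C^4}}{\varepsilon}.$$ Here $c_1,c_2>0$ are absolute constants and $D$ is a function of $\alpha$, $\varepsilon$ and $\|h\|_{C^4}$ only, so $D$ and $c$ do not depend on $N$, $G$ or $x$. (If $\|h\|_{C^4}=0$ then $D=0$ and the frequency is $0$.) -/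

import Mathlib

open MeasureTheory ProbabilityTheory Filter Topology Asymptotics

namespace HubReduction

noncomputable section

/-- The circle `ℝ / ℤ`, with its arc-length distance. -/
abbrev Circ := UnitAddCircle

/-! ### The Chung-Lu random power-law graph -/

/-- The power-law expected degree sequence with exponent `β`, `n` nodes, maximal expected degree `m`
and mean expected degree `w`.  The node called `i : Fin n` is the node number `i + 1` of `1, …, n`,
so the term `i - 1` of the usual formula reads `i` here. -/
def chungLuWeight (β : ℝ) (n : ℕ) (m w : ℝ) (i : Fin n) : ℝ :=
  (β - 2) / (β - 1) * w * (n : ℝ) ^ (1 / (β - 1)) *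
    ((n : ℝ) * (w * (β - 2) / (m * (β - 1))) ^ (β - 1) + ((i : ℕ) : ℝ)) ^ (-(1 / (β - 1)))

/-- The probability `w_i w_j / ∑ w_k` of a link between `i` and `j`, truncated to `[0, 1]`. -/
def linkProb (β : ℝ) (n : ℕ) (m w : ℝ) : Sym2 (Fin n) → unitInterval :=
  Sym2.lift ⟨fun i j => Set.projIcc (0 : ℝ) 1 zero_le_one
    (chungLuWeight β n m w i * chungLuWeight β n m w j / ∑ k, chungLuWeight β n m w k),
    fun i j => by
      beta_reduce
      rw [mul_comm (chungLuWeight β n m w i) (chungLuWeight β n m w j)]⟩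

/-- The law of the Chung-Lu random graph on `n` nodes: the links between distinct nodes are
independent, and `i`, `j` are linked with probability `linkProb` (loops are discarded). -/
def chungLuLaw (β : ℝ) (n : ℕ) (m w : ℝ) : Measure (SimpleGraph (Fin n)) :=
  (Measure.pi fun e : Sym2 (Fin n) => bernoulliMeasure True False (linkProb β n m w e)).map
    fun X => SimpleGraph.fromEdgeSet {e | X e}

instance (β : ℝ) (n : ℕ) (m w : ℝ) : IsProbabilityMeasure (chungLuLaw β n m w) := by
  unfold chungLuLaw
  refine Measure.isProbabilityMeasure_map (Measurable.aemeasurable ?_)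
  refine SimpleGraph.measurable_fromEdgeSet.comp (measurable_set_iff.2 fun e => ?_)
  exact measurable_pi_apply e

/-- The parameter regime of the locally star-like random power-law graph model, as the number `n` of
nodes grows: power-law exponent `β > 2`, maximal expected degree `m ≍ n ^ (1 / (β - 1))`, mean
expected degree `w = o(n ^ (lamLdn / (β - 1)))`, hub scale `Δ ∼ lamHub * m` and low degree scale
`δ ∼ cLdn * m ^ lamLdn` with `cLdn ≍ 1`, that is, `δ ≍ m ^ lamLdn`. -/
structure PowerLawRegime (β lamHub lamLdn : ℝ) (m w : ℕ → ℝ) (Δ δ : ℕ → ℕ) : Prop where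
  two_lt : 2 < β
  lamHub_mem : lamHub ∈ Set.Ioo (0 : ℝ) 1
  lamLdn_mem : lamLdn ∈ Set.Ioo (0 : ℝ) 1
  m_pos : ∀ n, 0 < m n
  w_pos : ∀ n, 0 < w n
  hubScale_pos : ∀ n, 0 < Δ n
  m_isTheta : m =Θ[atTop] fun n : ℕ => (n : ℝ) ^ (1 / (β - 1))
  w_isLittleO : w =o[atTop] fun n : ℕ => (n : ℝ) ^ (lamLdn / (β - 1))
  hubScale_equiv : (fun n => (Δ n : ℝ)) ~[atTop] fun n => lamHub * m n
  lowScale_isTheta : (fun n => (δ n : ℝ)) =Θ[atTop] fun n => m n ^ lamLdn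

/-! ### Locally star-like networks -/

section Graph

variable {N : ℕ}

open Classical in
/-- The degree `k_i` of node `i`. -/
def deg (G : SimpleGraph (Fin N)) (i : Fin N) : ℕ := G.degree i

open Classical in
/-- The largest degree `Δ₀`. -/
def largestDegree (G : SimpleGraph (Fin N)) : ℕ := G.maxDegree

open Classical in
/-- The hubs: the nodes of degree at least `Δ`. -/
def hubs (G : SimpleGraph (Fin N)) (Δ : ℕ) : Finset (Fin N) :=
  Finset.univ.filter fun i => Δ ≤ deg G i

open Classical in
/-- The low degree nodes: the nodes of degree at most `δ`. -/
def lowDegreeNodes (G : SimpleGraph (Fin N)) (δ : ℕ) : Finset (Fin N) :=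
  Finset.univ.filter fun i => deg G i ≤ δ

open Classical in
/-- The star-like index `ν_i` at node `i`: the proportion of low degree nodes among its
neighbours. -/
def starIndex (G : SimpleGraph (Fin N)) (δ : ℕ) (i : Fin N) : ℝ :=
  ((G.neighborFinset i ∩ lowDegreeNodes G δ).card : ℝ) / (deg G i : ℝ)

/-- `G` is a `(Δ, δ, ν)`-locally star-like network. -/
def IsLocallyStarLike (G : SimpleGraph (Fin N)) (Δ δ : ℕ) (ν : ℝ) : Prop :=
  ∀ i ∈ hubs G Δ, ν ≤ starIndex G δ i

end Graph

/-! ### Norms of coupling functions -/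

/-- The `C⁰` norm of `g : 𝕋² → ℝ`. -/
def normC0 (g : Circ → Circ → ℝ) : ℝ := ⨆ p : Circ × Circ, |g p.1 p.2|

/-- The Lipschitz seminorm of `g : 𝕋² → ℝ`, for the maximum distance on `𝕋²`. -/
def lipSeminorm (g : Circ → Circ → ℝ) : ℝ :=
  ⨆ q : (Circ × Circ) × (Circ × Circ), |g q.1.1 q.1.2 - g q.2.1 q.2.2| / dist q.1 q.2

/-- The partial derivative `∂₁^a ∂₂^b g` at the point with coordinates `s, u : ℝ`. -/
def partialDeriv (a b : ℕ) (g : Circ → Circ → ℝ) (s u : ℝ) : ℝ :=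
  iteratedDeriv a (fun s' : ℝ => iteratedDeriv b (fun u' : ℝ => g (s' : Circ) (u' : Circ)) u) s

/-- `g : 𝕋² → ℝ` is `C⁴`: its periodic lift to the plane is. -/
def IsC4 (g : Circ → Circ → ℝ) : Prop :=
  ContDiff ℝ 4 fun p : ℝ × ℝ => g (p.1 : Circ) (p.2 : Circ)

/-- The `C⁴` norm of `g : 𝕋² → ℝ`: the largest sup norm of a partial derivative of order at
most `4`. -/
def normC4 (g : Circ → Circ → ℝ) : ℝ :=
  ⨆ q : {ab : ℕ × ℕ // ab.1 + ab.2 ≤ 4} × (ℝ × ℝ),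
    |partialDeriv q.1.1.1 q.1.1.2 g q.2.1 q.2.2|

/-! ### Random node dynamics -/

section Dynamics

variable {Ω : Type*} {N : ℕ}

/-- `φ` is a (measurable) random dynamical system on the circle over `θ`. -/
structure IsRDS [MeasurableSpace Ω] (θ : Ω → Ω) (φ : ℕ → Ω → Circ → Circ) : Prop where
  measurable : Measurable fun q : ℕ × Ω × Circ => φ q.1 q.2.1 q.2.2
  zero : ∀ ω x, φ 0 ω x = x
  cocycle : ∀ s t ω x, φ (t + s) ω x = φ t (θ^[s] ω) (φ s ω x)

/-- The random maps `φ_i(1, θ^t ω, ·)` are continuous, have the same distribution and are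
independent in time `t` and node `i`.  The space `C(𝕋, 𝕋)` is seen inside `𝕋 → 𝕋` with the product
`σ`-algebra, whose trace on `C(𝕋, 𝕋)` is the Borel `σ`-algebra of uniform convergence. -/
structure IIDNodeMaps [MeasurableSpace Ω] (P : Measure Ω) (θ : Ω → Ω)
    (φ : Fin N → ℕ → Ω → Circ → Circ) : Prop where
  continuous : ∀ i ω, Continuous (φ i 1 ω)
  identDistrib : ∀ i j t s, IdentDistrib (fun ω => φ i 1 (θ^[t] ω)) (fun ω => φ j 1 (θ^[s] ω)) P P
  indep : iIndepFun (fun (p : ℕ × Fin N) ω => φ p.2 1 (θ^[p.1] ω)) P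

/-- `m` is a stationary measure of the iid iteration of the random map `f`:
`∫ P(x, B) dm(x) = m(B)` for the transition probability `P(x, B) = ℙ(f_ω(x) ∈ B)`. -/
def IsStationary [MeasurableSpace Ω] (P : Measure Ω) (f : Ω → Circ → Circ) (m : Measure Circ) :
    Prop :=
  ∀ B : Set Circ, MeasurableSet B → ∫⁻ x, P {ω | f ω x ∈ B} ∂m = m B

/-- `m` is the unique stationary probability measure of `f`. -/
def IsUniqueStationary [MeasurableSpace Ω] (P : Measure Ω) (f : Ω → Circ → Circ)
    (m : Measure Circ) : Prop :=
  IsProbabilityMeasure m ∧ IsStationary P f m ∧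
    ∀ m' : Measure Circ, IsProbabilityMeasure m' → IsStationary P f m' → m' = m

/-- The pre-composition `f_ω ∘ f_{θω} ∘ ⋯ ∘ f_{θ^{n-1}ω}`. -/
def precomp (θ : Ω → Ω) (f : Ω → Circ → Circ) : ℕ → Ω → Circ → Circ
  | 0, _, p => p
  | n + 1, ω, p => f ω (precomp θ f n (θ ω) p)

/-- The coding map `ω ↦ lim_n f_ω ∘ f_{θω} ∘ ⋯ ∘ f_{θ^{n-1}ω}(p)`, for uniform contractions `f_ω`;
the limit then exists and does not depend on `p`, and `p = 0` is taken here. -/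
def codingMap (θ : Ω → Ω) (f : Ω → Circ → Circ) (ω : Ω) : Circ :=
  limUnder atTop fun n => precomp θ f n ω 0

/-- The random coupling function `h` has values in `C⁴(𝕋²; ℝ)`, and `h(θ^t ω, ·, ·)`, `t ∈ ℕ`, have
the same distribution and are independent.  The space `C⁴(𝕋²; ℝ)` is seen inside `𝕋² → ℝ` with the
product `σ`-algebra, whose trace on `C⁴(𝕋²; ℝ)` is the Borel `σ`-algebra of the `C⁴` norm. -/
structure IIDCoupling [MeasurableSpace Ω] (P : Measure Ω) (θ : Ω → Ω)
    (h : Ω → Circ → Circ → ℝ) : Prop where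
  isC4 : ∀ ω, IsC4 (h ω)
  measurable : Measurable fun q : Ω × Circ × Circ => h q.1 q.2.1 q.2.2
  identDistrib : ∀ t s, IdentDistrib (fun ω (p : Circ × Circ) => h (θ^[t] ω) p.1 p.2)
    (fun ω (p : Circ × Circ) => h (θ^[s] ω) p.1 p.2) P P
  indep : iIndepFun (fun (t : ℕ) ω (p : Circ × Circ) => h (θ^[t] ω) p.1 p.2) P

/-! ### Network dynamics and reduction -/

open Classical in
/-- The total interaction `α / Δ₀ * ∑ j, A i j * h(ω, x i, x j)` felt by node `i`. -/
def interaction (G : SimpleGraph (Fin N)) (α : ℝ) (h : Ω → Circ → Circ → ℝ) (ω : Ω)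
    (x : Fin N → Circ) (i : Fin N) : ℝ :=
  α * (1 / (largestDegree G : ℝ)) * ∑ j, if G.Adj i j then h ω (x i) (x j) else 0

/-- The network dynamics `x^t = Φ_α(t, ω, x)`. -/
def networkOrbit (G : SimpleGraph (Fin N)) (α : ℝ) (θ : Ω → Ω) (φ : Fin N → ℕ → Ω → Circ → Circ)
    (h : Ω → Circ → Circ → ℝ) : ℕ → Ω → (Fin N → Circ) → Fin N → Circ
  | 0, _, x => x
  | t + 1, ω, x => fun i =>
      φ i 1 (θ^[t] ω) (networkOrbit G α θ φ h t ω x i) +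
        ((interaction G α h (θ^[t] ω) (networkOrbit G α θ φ h t ω x) i : ℝ) : Circ)

/-- The reduced one-dimensional system `φ_{a,m}` of a node with isolated dynamics `φ`. -/
def reducedSystem (θ : Ω → Ω) (φ : ℕ → Ω → Circ → Circ) (h : Ω → Circ → Circ → ℝ) (a : ℝ)
    (m : Measure Circ) : ℕ → Ω → Circ → Circ
  | 0, _, z => z
  | t + 1, ω, z =>
      φ 1 (θ^[t] ω) (reducedSystem θ φ h a m t ω z) +
        ((a * ∫ y, h (θ^[t] ω) (reducedSystem θ φ h a m t ω z) y ∂m : ℝ) : Circ)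

/-- The fluctuation `ξ` of node `i` about the reduced system `φ_{a,m}`. -/
def fluctuation (G : SimpleGraph (Fin N)) (α : ℝ) (h : Ω → Circ → Circ → ℝ) (a : ℝ)
    (m : Measure Circ) (i : Fin N) (ω : Ω) (x : Fin N → Circ) : ℝ :=
  interaction G α h ω x i - a * ∫ y, h ω (x i) y ∂m

/-- Node `i` evolves by the reduced system up to the fluctuation:
`x_i^{t+1} = φ_{a,m}(1, θ^t ω, x_i^t) + ξ(θ^t ω, x^t)`. -/
theorem networkOrbit_succ (G : SimpleGraph (Fin N)) (α : ℝ) (θ : Ω → Ω)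
    (φ : Fin N → ℕ → Ω → Circ → Circ) (h : Ω → Circ → Circ → ℝ) (a : ℝ) (m : Measure Circ)
    (i : Fin N) (t : ℕ) (ω : Ω) (x : Fin N → Circ) :
    networkOrbit G α θ φ h (t + 1) ω x i =
      reducedSystem θ (φ i) h a m 1 (θ^[t] ω) (networkOrbit G α θ φ h t ω x i) +
        ((fluctuation G α h a m i (θ^[t] ω) (networkOrbit G α θ φ h t ω x) : ℝ) : Circ) := by
  simp only [networkOrbit, reducedSystem, fluctuation, Function.iterate_zero, id, add_assoc,
    ← AddCircle.coe_add]
  congr 3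
  ring

open Classical in
/-- Node `i` admits `ε`-reduction to `φ_{a,m}` on the initial data `(ω, x)` with exceptional
frequency at most `ρ`: the upper asymptotic frequency of the times at which the fluctuation exceeds
`ε` in absolute value is at most `ρ`. -/
def AdmitsReduction (G : SimpleGraph (Fin N)) (α : ℝ) (θ : Ω → Ω)
    (φ : Fin N → ℕ → Ω → Circ → Circ) (h : Ω → Circ → Circ → ℝ) (a : ℝ) (m : Measure Circ)
    (i : Fin N) (ω : Ω) (x : Fin N → Circ) (ε ρ : ℝ) : Prop :=
  limsup (fun T : ℕ => (((Finset.range T).filter fun t =>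
      ε < |fluctuation G α h a m i (θ^[t] ω) (networkOrbit G α θ φ h t ω x)|).card : ℝ) / (T : ℝ))
    atTop ≤ ρ

/-- `sup_t ‖h(θ^t ω, ·, ·)‖_{C⁰}`. -/
def supC0 (θ : Ω → Ω) (h : Ω → Circ → Circ → ℝ) (ω : Ω) : ℝ := ⨆ t : ℕ, normC0 (h (θ^[t] ω))

/-- `sup_t |h(θ^t ω, ·, ·)|_{Lip}`. -/
def supLip (θ : Ω → Ω) (h : Ω → Circ → Circ → ℝ) (ω : Ω) : ℝ := ⨆ t : ℕ, lipSeminorm (h (θ^[t] ω))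

/-- `sup_t ‖h(θ^t ω, ·, ·)‖_{C⁴}`; a meaningful value only where the norms are bounded in `t`. -/
def supC4 (θ : Ω → Ω) (h : Ω → Circ → Circ → ℝ) (ω : Ω) : ℝ := ⨆ t : ℕ, normC4 (h (θ^[t] ω))

end Dynamics

end

end HubReduction

open HubReduction

namespace HubReduction

section

/-! ### Calculus on the circle and the torus -/

/-! One step of the network moves a low degree node by at most `α δ ‖h‖ / Δ₀`, and contraction sums
these errors geometrically, so the node shadows its isolated orbit (`dist_networkOrbit_le`). Up to
this error and the high degree neighbours, the fluctuation of a hub is a centred sum of `h(θ^t ω,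
x_i^t, y_j)` over isolated orbits `y_j` (`abs_fluctuation_le`).

These orbits are independent across nodes, but the hub state and the coupling may depend on the same
noise, so Hoeffding's inequality does not apply to this sum directly. A Fourier expansion in the
second variable separates them: `C⁴` regularity bounds the `k`-th coefficient by `‖h‖_{C⁴} /
(2π|k|)^4` whatever the hub state, so it is enough to control the character sums with a tolerance
proportional to `|k|` (`abs_sum_sub_integral_le`). For large `|k|` the tolerance exceeds the trivial
bound; the finitely many other characters obey Hoeffding (`measureReal_deviationEvent_le`), and
their number produces the prefactor `D`.

To turn probabilities into frequencies, contraction is used again: `y_j` at time `t` is replaced by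
the orbit started from `0` at time `t - r`. The bad event at time `t` is then seen at `θ^(t-r) ω`
and depends on `r` consecutive times only, so the strong law along residue classes gives its
frequency (`ae_eventually_card_le`), without ergodicity of `θ`.

The formula for `m₀` follows from `π(ω) = f_ω(π(θω))`, where `π(θω)` is independent of `f_ω`: the
law of `π` is stationary, and uniqueness identifies it (`eq_map_codingMap`). -/

theorem exists_coe_eq_abs_sub_eq_dist (x y : Circ) (s : ℝ) (hs : (s : Circ) = x) :
    ∃ s' : ℝ, (s' : Circ) = y ∧ |s' - s| = dist x y := by
  obtain ⟨v, rfl⟩ := QuotientAddGroup.mk_surjective y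
  subst hs
  -- Removing the integer nearest to `v - s` selects the lift of `y` closest to `s`.
  refine ⟨v - round (v - s), ?_, ?_⟩
  · have : ((round (v - s) : ℝ) : Circ) = 0 := by
      have := AddCircle.coe_period (1 : ℝ)
      rw [← zsmul_one (round (v - s)), AddCircle.coe_zsmul, this, smul_zero]
    rw [AddCircle.coe_sub, this, sub_zero]
  · rw [dist_comm, dist_eq_norm]
    change _ = ‖((v : Circ) - (s : Circ))‖
    rw [← AddCircle.coe_sub, UnitAddCircle.norm_eq]
    congr 1
    ring

/-- A derivative in the second variable is the Fréchet derivative applied to `(0, 1)`, so each one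
costs one order of joint smoothness. -/
theorem contDiff_iteratedDeriv_snd {m b : ℕ} {F : ℝ × ℝ → ℝ}
    (hF : ContDiff ℝ ((m + b : ℕ) : WithTop ℕ∞) F) :
    ContDiff ℝ m fun p : ℝ × ℝ => iteratedDeriv b (fun u => F (p.1, u)) p.2 := by
  induction b generalizing m with
  | zero => simpa using hF
  | succ b ih =>
    have h1 : ContDiff ℝ ((m + 1 : ℕ) : WithTop ℕ∞)
        fun p : ℝ × ℝ => iteratedDeriv b (fun u => F (p.1, u)) p.2 :=
      ih (by convert hF using 2; omega)
    set K : ℝ × ℝ → ℝ := fun p => iteratedDeriv b (fun u => F (p.1, u)) p.2 with hK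
    have h2 : (fun p : ℝ × ℝ => iteratedDeriv (b + 1) (fun u => F (p.1, u)) p.2) =
        fun p => fderiv ℝ K p (0, 1) := by
      funext p
      rw [iteratedDeriv_succ]
      have hd : HasFDerivAt K (fderiv ℝ K p) (p.1, p.2) :=
        (h1.differentiable (by simp) p).hasFDerivAt
      have hl : HasDerivAt (fun u : ℝ => (p.1, u)) ((0 : ℝ), (1 : ℝ)) p.2 :=
        (hasDerivAt_const _ _).prodMk (hasDerivAt_id _)
      exact (hd.comp_hasDerivAt p.2 hl).deriv
    rw [h2]
    have h3 : ContDiff ℝ m (fderiv ℝ K) := h1.fderiv_right (by push_cast; exact le_rfl)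
    exact h3.clm_apply contDiff_const

theorem periodic_iteratedDeriv {f : ℝ → ℝ} {c : ℝ} (hf : Function.Periodic f c) (n : ℕ) :
    Function.Periodic (iteratedDeriv n f) c := by
  intro x
  have h := congrFun (iteratedDeriv_comp_add_const n f c) x
  rw [← h]
  congr 1
  funext z
  exact hf z

theorem Circ.coe_add_one (s : ℝ) : ((s + 1 : ℝ) : Circ) = s := AddCircle.coe_add_period 1 s

theorem partialDeriv_add_one_left (a b : ℕ) (g : Circ → Circ → ℝ) (s u : ℝ) :
    partialDeriv a b g (s + 1) u = partialDeriv a b g s u :=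
  periodic_iteratedDeriv (fun s' => by simp only [Circ.coe_add_one]) a s

theorem partialDeriv_add_one_right (a b : ℕ) (g : Circ → Circ → ℝ) (s u : ℝ) :
    partialDeriv a b g s (u + 1) = partialDeriv a b g s u := by
  unfold partialDeriv
  congr 1
  funext s'
  exact periodic_iteratedDeriv (fun u' => by simp only [Circ.coe_add_one]) b u

theorem continuous_partialDeriv {a b : ℕ} (hab : a + b ≤ 4) {g : Circ → Circ → ℝ} (hg : IsC4 g) :
    Continuous fun p : ℝ × ℝ => partialDeriv a b g p.1 p.2 := by
  have h1 : ContDiff ℝ ((0 + a : ℕ) : WithTop ℕ∞) fun p : ℝ × ℝ =>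
      iteratedDeriv b (fun u' : ℝ => g (p.1 : Circ) (u' : Circ)) p.2 :=
    contDiff_iteratedDeriv_snd (F := fun p : ℝ × ℝ => g (p.1 : Circ) (p.2 : Circ))
      (hg.of_le (by norm_cast; omega))
  -- Swapping the coordinates lets the same lemma handle the `a` derivatives in the first variable.
  have h2 := contDiff_iteratedDeriv_snd (h1.comp (contDiff_snd.prodMk contDiff_fst))
  exact h2.continuous.comp (continuous_snd.prodMk continuous_fst)

theorem bddAbove_abs_of_periodic {F : ℝ × ℝ → ℝ} (hF : Continuous F)
    (h1 : ∀ s u, F (s + 1, u) = F (s, u)) (h2 : ∀ s u, F (s, u + 1) = F (s, u)) :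
    ∃ C, ∀ p, |F p| ≤ C := by
  obtain ⟨C, hC⟩ := (isCompact_Icc (a := ((0, 0) : ℝ × ℝ)) (b := (1, 1))).exists_bound_of_continuousOn
    hF.continuousOn
  refine ⟨C, fun p => ?_⟩
  obtain ⟨s, hs, hs'⟩ := Function.Periodic.exists_mem_Ico₀
    (f := fun s => F (s, p.2)) (c := 1) (fun s => h1 s p.2) one_pos p.1
  obtain ⟨u, hu, hu'⟩ := Function.Periodic.exists_mem_Ico₀
    (f := fun u => F (s, u)) (c := 1) (fun u => h2 s u) one_pos p.2
  have := hC (s, u) ⟨⟨hs.1, hu.1⟩, ⟨hs.2.le, hu.2.le⟩⟩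
  rw [Real.norm_eq_abs] at this
  rw [show F p = F (s, u) from hs'.trans hu']
  exact this

/-- Without boundedness the real supremum `normC4` would take the default value `0`. Only finitely
many orders occur, and each derivative is continuous and periodic. -/
theorem bddAbove_partialDeriv {g : Circ → Circ → ℝ} (hg : IsC4 g) :
    BddAbove (Set.range fun q : {ab : ℕ × ℕ // ab.1 + ab.2 ≤ 4} × (ℝ × ℝ) =>
      |partialDeriv q.1.1.1 q.1.1.2 g q.2.1 q.2.2|) := by
  have hfin : Finite {ab : ℕ × ℕ // ab.1 + ab.2 ≤ 4} :=
    Set.Finite.to_subtype ((Set.finite_Iic ((4, 4) : ℕ × ℕ)).subset fun ab h => by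
      have h : ab.1 + ab.2 ≤ 4 := h
      exact ⟨by simp only; omega, by simp only; omega⟩)
  have : ∀ ab : {ab : ℕ × ℕ // ab.1 + ab.2 ≤ 4}, ∃ C, ∀ p : ℝ × ℝ,
      |partialDeriv ab.1.1 ab.1.2 g p.1 p.2| ≤ C := fun ab =>
    bddAbove_abs_of_periodic (continuous_partialDeriv ab.2 hg)
      (fun s u => partialDeriv_add_one_left _ _ g s u)
      (fun s u => partialDeriv_add_one_right _ _ g s u)
  choose C hC using this
  obtain ⟨B, hB⟩ := (Set.finite_range C).bddAbove
  refine ⟨B, ?_⟩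
  rintro _ ⟨q, rfl⟩
  exact (hC q.1 q.2).trans (hB ⟨q.1, rfl⟩)

theorem abs_partialDeriv_le_normC4 {g : Circ → Circ → ℝ} (hg : IsC4 g) {a b : ℕ}
    (hab : a + b ≤ 4) (s u : ℝ) : |partialDeriv a b g s u| ≤ normC4 g :=
  le_ciSup (bddAbove_partialDeriv hg)
    ((⟨(a, b), hab⟩, (s, u)) : {ab : ℕ × ℕ // ab.1 + ab.2 ≤ 4} × (ℝ × ℝ))

theorem normC4_nonneg (g : Circ → Circ → ℝ) : 0 ≤ normC4 g :=
  Real.iSup_nonneg fun _ => abs_nonneg _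

theorem abs_le_normC4 {g : Circ → Circ → ℝ} (hg : IsC4 g) (x y : Circ) : |g x y| ≤ normC4 g := by
  obtain ⟨s, rfl⟩ := QuotientAddGroup.mk_surjective x
  obtain ⟨u, rfl⟩ := QuotientAddGroup.mk_surjective y
  simpa [partialDeriv] using abs_partialDeriv_le_normC4 hg (a := 0) (b := 0) (by norm_num) s u

theorem abs_le_normC0 {g : Circ → Circ → ℝ} (hg : IsC4 g) (x y : Circ) : |g x y| ≤ normC0 g :=
  le_ciSup (f := fun p : Circ × Circ => |g p.1 p.2|)
    ⟨normC4 g, by rintro _ ⟨p, rfl⟩; exact abs_le_normC4 hg p.1 p.2⟩ (x, y)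

theorem normC0_le_normC4 {g : Circ → Circ → ℝ} (hg : IsC4 g) : normC0 g ≤ normC4 g :=
  ciSup_le fun p => abs_le_normC4 hg p.1 p.2

theorem contDiff_right {g : Circ → Circ → ℝ} (hg : IsC4 g) (x : Circ) :
    ContDiff ℝ 4 fun u : ℝ => g x (u : Circ) := by
  obtain ⟨s, rfl⟩ := QuotientAddGroup.mk_surjective x
  exact hg.comp (contDiff_const.prodMk contDiff_id)

theorem contDiff_left {g : Circ → Circ → ℝ} (hg : IsC4 g) (y : Circ) :
    ContDiff ℝ 4 fun s : ℝ => g (s : Circ) y := by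
  obtain ⟨u, rfl⟩ := QuotientAddGroup.mk_surjective y
  exact hg.comp (contDiff_id.prodMk contDiff_const)

theorem abs_sub_le_mul_dist_of_deriv {f : Circ → ℝ} {C : ℝ}
    (hf : ContDiff ℝ 4 fun u : ℝ => f (u : Circ))
    (hC : ∀ u : ℝ, |deriv (fun u : ℝ => f (u : Circ)) u| ≤ C) (x y : Circ) :
    |f x - f y| ≤ C * dist x y := by
  obtain ⟨s, rfl⟩ := QuotientAddGroup.mk_surjective x
  obtain ⟨s', rfl, h⟩ := exists_coe_eq_abs_sub_eq_dist _ y s rfl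
  rw [← h, abs_sub_comm]
  exact Convex.norm_image_sub_le_of_norm_deriv_le (f := fun u : ℝ => f (u : Circ))
    (fun x _ => hf.differentiable (by norm_num) x) (fun x _ => hC x) convex_univ
    (Set.mem_univ s) (Set.mem_univ s')

/-- One coordinate is moved at a time, each at the cost of one first order derivative; hence the
factor `2` for the maximum distance. -/
theorem abs_sub_le_two_mul_normC4_mul_dist {g : Circ → Circ → ℝ} (hg : IsC4 g)
    (p q : Circ × Circ) : |g p.1 p.2 - g q.1 q.2| ≤ 2 * normC4 g * dist p q := by
  have h1 : |g p.1 p.2 - g q.1 p.2| ≤ normC4 g * dist p.1 q.1 := by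
    refine abs_sub_le_mul_dist_of_deriv (f := fun s => g s p.2) (contDiff_left hg _) (fun s => ?_) _ _
    obtain ⟨u, hu⟩ := QuotientAddGroup.mk_surjective p.2
    have := abs_partialDeriv_le_normC4 hg (a := 1) (b := 0) (by norm_num) s u
    simp only [partialDeriv, iteratedDeriv_zero, iteratedDeriv_one] at this
    rw [← hu]
    exact this
  have h2 : |g q.1 p.2 - g q.1 q.2| ≤ normC4 g * dist p.2 q.2 := by
    refine abs_sub_le_mul_dist_of_deriv (contDiff_right hg _) (fun u => ?_) _ _
    obtain ⟨s, hs⟩ := QuotientAddGroup.mk_surjective q.1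
    have := abs_partialDeriv_le_normC4 hg (a := 0) (b := 1) (by norm_num) s u
    simp only [partialDeriv, iteratedDeriv_zero, iteratedDeriv_one] at this
    rw [← hs]
    exact this
  have h3 : dist p.1 q.1 ≤ dist p q := le_max_left _ _
  have h4 : dist p.2 q.2 ≤ dist p q := le_max_right _ _
  have h0 := normC4_nonneg g
  calc |g p.1 p.2 - g q.1 q.2| ≤ |g p.1 p.2 - g q.1 p.2| + |g q.1 p.2 - g q.1 q.2| :=
        abs_sub_le _ _ _
    _ ≤ normC4 g * dist p q + normC4 g * dist p q := by gcongr <;> nlinarith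
    _ = _ := by ring

theorem lipSeminorm_quotient_le {g : Circ → Circ → ℝ} (hg : IsC4 g)
    (q : (Circ × Circ) × (Circ × Circ)) :
    |g q.1.1 q.1.2 - g q.2.1 q.2.2| / dist q.1 q.2 ≤ 2 * normC4 g :=
  div_le_of_le_mul₀ dist_nonneg (mul_nonneg zero_le_two (normC4_nonneg g))
    (abs_sub_le_two_mul_normC4_mul_dist hg _ _)

theorem lipSeminorm_le {g : Circ → Circ → ℝ} (hg : IsC4 g) : lipSeminorm g ≤ 2 * normC4 g :=
  ciSup_le (lipSeminorm_quotient_le hg)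

theorem lipSeminorm_nonneg (g : Circ → Circ → ℝ) : 0 ≤ lipSeminorm g :=
  Real.iSup_nonneg fun _ => by positivity

theorem abs_sub_le_lipSeminorm_mul_dist {g : Circ → Circ → ℝ} (hg : IsC4 g) (x y y' : Circ) :
    |g x y - g x y'| ≤ lipSeminorm g * dist y y' := by
  rcases eq_or_ne y y' with rfl | hne
  · simp
  have hd : dist (x, y) (x, y') = dist y y' := by simp [Prod.dist_eq]
  have hpos : 0 < dist y y' := dist_pos.2 hne
  have := le_ciSup (f := fun q : (Circ × Circ) × (Circ × Circ) =>
    |g q.1.1 q.1.2 - g q.2.1 q.2.2| / dist q.1 q.2)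
    ⟨_, by rintro _ ⟨q, rfl⟩; exact lipSeminorm_quotient_le hg q⟩ ((x, y), (x, y'))
  simp only [hd] at this
  exact (div_le_iff₀ hpos).1 this

/-! ### Fourier coefficients of smooth functions on the circle -/

theorem fourier_sub_le (k : ℤ) (x y : Circ) :
    ‖fourier k x - fourier k y‖ ≤ 2 * Real.pi * |(k : ℝ)| * dist x y := by
  obtain ⟨s, rfl⟩ := QuotientAddGroup.mk_surjective x
  obtain ⟨s', rfl, h⟩ := exists_coe_eq_abs_sub_eq_dist _ y s rfl
  rw [← h]
  have e : ∀ v : ℝ, fourier k (v : Circ) = Complex.exp (Complex.I * ((2 * Real.pi * k * v : ℝ) : ℂ)) := by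
    intro v
    rw [fourier_coe_apply]
    congr 1
    push_cast
    ring
  have hm : ‖(fourier k ((s : ℝ) : Circ) : ℂ)‖ = 1 := by rw [fourier_apply]; exact Circle.norm_coe _
  have : fourier k ((s' : ℝ) : Circ) = fourier k ((s : ℝ) : Circ) *
      Complex.exp (Complex.I * ((2 * Real.pi * k * (s' - s) : ℝ) : ℂ)) := by
    rw [e, e, ← Complex.exp_add]
    congr 1
    push_cast
    ring
  rw [this, norm_sub_rev, ← mul_sub_one, norm_mul, hm, one_mul]
  refine (Real.norm_exp_I_mul_ofReal_sub_one_le).trans_eq ?_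
  rw [Real.norm_eq_abs, abs_mul, abs_mul, abs_of_pos Real.two_pi_pos]

/-- Repeated integration by parts: the boundary terms cancel by periodicity, and each step divides
by `2π|k|`. -/
theorem norm_fourierCoeffOn_iteratedDeriv {F : ℝ → ℝ} {n : ℕ} (hF : ContDiff ℝ n F)
    (hper : Function.Periodic F 1) {k : ℤ} (hk : k ≠ 0) {b : ℕ} (hb : b ≤ n) :
    ‖fourierCoeffOn zero_lt_one (fun u => ((F u : ℝ) : ℂ)) k‖ =
      ‖fourierCoeffOn zero_lt_one (fun u => ((iteratedDeriv b F u : ℝ) : ℂ)) k‖ /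
        (2 * Real.pi * |(k : ℝ)|) ^ b := by
  induction b with
  | zero => simp
  | succ b ih =>
    have hd : ∀ x ∈ Set.uIcc (0 : ℝ) 1, HasDerivAt (fun u => ((iteratedDeriv b F u : ℝ) : ℂ))
        ((iteratedDeriv (b + 1) F x : ℝ) : ℂ) x := by
      intro x _
      have h1 : Differentiable ℝ (iteratedDeriv b F) :=
        hF.differentiable_iteratedDeriv b (by norm_cast)
      have h2 := (h1 x).hasDerivAt
      rw [← iteratedDeriv_succ] at h2
      exact h2.ofReal_comp
    have hc : IntervalIntegrable (fun u => ((iteratedDeriv (b + 1) F u : ℝ) : ℂ)) volume 0 1 :=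
      (Complex.continuous_ofReal.comp
        (hF.continuous_iteratedDeriv (b + 1) (by norm_cast))).intervalIntegrable _ _
    have h := fourierCoeffOn_of_hasDerivAt zero_lt_one hk hd hc
    have hp : iteratedDeriv b F 1 = iteratedDeriv b F 0 := by
      simpa using periodic_iteratedDeriv hper b 0
    rw [ih (by omega), h, hp, sub_self, mul_zero, zero_sub, norm_mul, norm_neg, pow_succ]
    simp only [sub_zero, Complex.ofReal_one, Complex.ofReal_zero, one_mul, norm_div, norm_one, norm_mul, norm_neg,
      Complex.norm_ofNat, Complex.norm_real, Complex.norm_I, mul_one, Complex.norm_intCast,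
      Real.norm_eq_abs, abs_of_pos Real.pi_pos]
    have : (0 : ℝ) < |(k : ℝ)| := by positivity
    field_simp

theorem norm_fourierCoeff_le {f : Circ → ℝ} {n : ℕ} {H : ℝ}
    (hf : ContDiff ℝ n fun u : ℝ => f (u : Circ))
    (hH : ∀ u : ℝ, |iteratedDeriv n (fun u : ℝ => f (u : Circ)) u| ≤ H) {k : ℤ} (hk : k ≠ 0) :
    ‖fourierCoeff (fun x : Circ => ((f x : ℝ) : ℂ)) k‖ ≤ H / (2 * Real.pi * |(k : ℝ)|) ^ n := by
  have hper : Function.Periodic (fun u : ℝ => f (u : Circ)) 1 := fun u => by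
    simp only [Circ.coe_add_one]
  have h1 : fourierCoeff (fun x : Circ => ((f x : ℝ) : ℂ)) k =
      fourierCoeffOn zero_lt_one (fun u : ℝ => ((f (u : Circ) : ℝ) : ℂ)) k := by
    rw [fourierCoeff_eq_intervalIntegral _ _ 0, fourierCoeffOn_eq_integral]
    simp
  rw [h1, norm_fourierCoeffOn_iteratedDeriv hf hper hk le_rfl]
  gcongr
  rw [fourierCoeffOn_eq_integral]
  simp only [sub_zero, div_one, one_smul]
  refine (intervalIntegral.norm_integral_le_of_norm_le_const (C := H) fun x _ => ?_).trans (by simp)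
  rw [norm_smul, Complex.norm_real, fourier_apply, Circle.norm_coe, one_mul]
  exact hH x

theorem continuous_of_contDiff_lift {f : Circ → ℝ} {n : WithTop ℕ∞}
    (hf : ContDiff ℝ n fun u : ℝ => f (u : Circ)) : Continuous f :=
  (QuotientAddGroup.isOpenQuotientMap_mk.isQuotientMap.continuous_iff).2 hf.continuous

/-- Each half-line contributes `ζ(2)`; the index `0`, common to both, contributes `1 / 0 = 0`. -/
theorem hasSum_one_div_int_sq : HasSum (fun k : ℤ => 1 / (k : ℝ) ^ 2) (Real.pi ^ 2 / 3) := by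
  have h1 : HasSum (fun n : ℕ => 1 / (((n : ℤ) : ℝ)) ^ 2) (Real.pi ^ 2 / 6) := by
    simpa using hasSum_zeta_two
  have h2 : HasSum (fun n : ℕ => 1 / (((-(n : ℤ) : ℤ) : ℝ)) ^ 2) (Real.pi ^ 2 / 6) := by
    simpa using hasSum_zeta_two
  have e : Real.pi ^ 2 / 3 = Real.pi ^ 2 / 6 + Real.pi ^ 2 / 6 - 1 / ((0 : ℤ) : ℝ) ^ 2 := by
    rw [Int.cast_zero, zero_pow two_ne_zero, div_zero]
    ring
  rw [e]
  exact HasSum.of_nat_of_neg (f := fun k : ℤ => 1 / (k : ℝ) ^ 2) h1 h2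

/-- The empirical measure of finitely many points integrates smooth functions almost as `μ` does as
soon as it does so for the characters. -/
theorem abs_sum_sub_integral_le {ι : Type*} (S : Finset ι) (y : ι → Circ) (μ : Measure Circ)
    [IsProbabilityMeasure μ] {f : Circ → ℝ} {H τ : ℝ}
    (hf : ContDiff ℝ 4 fun u : ℝ => f (u : Circ))
    (hH : ∀ u : ℝ, |iteratedDeriv 4 (fun u : ℝ => f (u : Circ)) u| ≤ H)
    (hτ : ∀ k : ℤ, k ≠ 0 →
      ‖∑ j ∈ S, ((fourier k (y j) : ℂ) - ∫ z, (fourier k z : ℂ) ∂μ)‖ ≤ τ * |(k : ℝ)|) :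
    |∑ j ∈ S, (f (y j) - ∫ z, f z ∂μ)| ≤ H * τ / 400 := by
  have hfc : Continuous f := continuous_of_contDiff_lift hf
  set F : C(Circ, ℂ) := ⟨fun x => ((f x : ℝ) : ℂ), Complex.continuous_ofReal.comp hfc⟩ with hF
  set c : ℤ → ℂ := fourierCoeff F with hc
  have hH0 : 0 ≤ H := (abs_nonneg _).trans (hH 0)
  have hτ0 : 0 ≤ τ := by
    have := (norm_nonneg _).trans (hτ 1 one_ne_zero)
    simpa using this
  have hck : ∀ k : ℤ, k ≠ 0 → ‖c k‖ ≤ H / (2 * Real.pi * |(k : ℝ)|) ^ 4 := fun k hk =>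
    norm_fourierCoeff_le (n := 4) (f := f) hf hH hk
  have hπ := Real.pi_gt_three
  have one_le : ∀ k : ℤ, k ≠ 0 → (1 : ℝ) ≤ |(k : ℝ)| := fun k hk => by
    exact_mod_cast Int.one_le_abs hk
  -- A cruder decay, enough for the absolute convergence of the Fourier series.
  have hck' : ∀ k : ℤ, k ≠ 0 → ‖c k‖ ≤ H * (1 / (k : ℝ) ^ 2) := by
    intro k hk
    refine (hck k hk).trans ?_
    rw [mul_one_div, ← sq_abs (k : ℝ)]
    have h1 := one_le k hk
    refine div_le_div_of_nonneg_left hH0 (by positivity) ?_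
    have h2 : |(k : ℝ)| ≤ 2 * Real.pi * |(k : ℝ)| := by nlinarith
    calc |(k : ℝ)| ^ 2 ≤ |(k : ℝ)| ^ 4 := pow_le_pow_right₀ h1 (by norm_num)
      _ ≤ _ := by gcongr
  have hsum : Summable c := by
    refine Summable.of_norm_bounded_eventually (g := fun k : ℤ => H * (1 / (k : ℝ) ^ 2))
      (hasSum_one_div_int_sq.summable.mul_left H) ?_
    filter_upwards [(Set.finite_singleton (0 : ℤ)).compl_mem_cofinite] with k hk
    exact hck' k hk
  have hnorm : ∀ (k : ℤ) (z : Circ), ‖(fourier k z : ℂ)‖ = 1 := fun k z => by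
    rw [fourier_apply]; exact Circle.norm_coe _
  have hpt : ∀ z, HasSum (fun k => c k * (fourier k z : ℂ)) ((f z : ℝ) : ℂ) := fun z =>
    has_pointwise_sum_fourier_series_of_summable hsum z
  have hint : ∀ k, Integrable (fun z => (fourier k z : ℂ)) μ := fun k =>
    Integrable.of_bound (C := 1) (ContinuousMap.continuous _).aestronglyMeasurable
      (ae_of_all _ fun z => (hnorm k z).le)
  have hI : HasSum (fun k => c k * ∫ z, (fourier k z : ℂ) ∂μ) ((∫ z, f z ∂μ : ℝ) : ℂ) := by
    have := hasSum_integral_of_summable_integral_norm (μ := μ)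
      (F := fun k z => c k * (fourier k z : ℂ)) (fun k => (hint k).const_mul (c k)) (by
        simpa only [norm_mul, hnorm, mul_one, integral_const, probReal_univ, one_smul]
          using hsum.norm)
    have e : ∫ z, ∑' k, c k * (fourier k z : ℂ) ∂μ = ((∫ z, f z ∂μ : ℝ) : ℂ) := by
      rw [← integral_complex_ofReal]
      exact integral_congr_ae (ae_of_all _ fun z => (hpt z).tsum_eq)
    simpa only [integral_const_mul, e] using this
  have hS : HasSum (fun k => c k * ∑ j ∈ S, ((fourier k (y j) : ℂ) - ∫ z, (fourier k z : ℂ) ∂μ))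
      ((∑ j ∈ S, (f (y j) - ∫ z, f z ∂μ) : ℝ) : ℂ) := by
    push_cast
    simp only [Finset.mul_sum, mul_sub]
    exact hasSum_sum fun j _ => (hpt (y j)).sub hI
  -- The tolerance `τ|k|` uses up one power of the decay `|k|⁻⁴`; the remaining cube is bounded by
  -- the square, whose sum is explicit.
  have hb : ∀ k : ℤ, ‖c k * ∑ j ∈ S, ((fourier k (y j) : ℂ) - ∫ z, (fourier k z : ℂ) ∂μ)‖ ≤
      H * τ / (2 * Real.pi) ^ 4 * (1 / (k : ℝ) ^ 2) := by
    intro k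
    rcases eq_or_ne k 0 with rfl | hk
    · simp
    have h1 := one_le k hk
    rw [norm_mul]
    calc _ ≤ H / (2 * Real.pi * |(k : ℝ)|) ^ 4 * (τ * |(k : ℝ)|) := by
          gcongr
          exacts [hck k hk, hτ k hk]
      _ = H * τ / (2 * Real.pi) ^ 4 * (1 / |(k : ℝ)| ^ 3) := by
          field_simp
      _ ≤ H * τ / (2 * Real.pi) ^ 4 * (1 / |(k : ℝ)| ^ 2) := by
          gcongr ?_ * (1 / ?_)
          exact pow_le_pow_right₀ h1 (by norm_num)
      _ = _ := by rw [sq_abs]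
  have h := tsum_of_norm_bounded (hasSum_one_div_int_sq.mul_left (H * τ / (2 * Real.pi) ^ 4)) hb
  rw [hS.tsum_eq, Complex.norm_real, Real.norm_eq_abs] at h
  refine h.trans ?_
  -- The constant `400` comes from `48 π² ≥ 432`.
  have : H * τ / (2 * Real.pi) ^ 4 * (Real.pi ^ 2 / 3) = H * τ / (48 * Real.pi ^ 2) := by
    field_simp
    ring
  rw [this]
  gcongr
  nlinarith

end

section

/-! ### The `σ`-algebras of the random node maps -/

variable {Ω : Type*} {N : ℕ}

/-- The `σ`-algebra generated by the random maps `φ_i(1, θ^t ω, ·)` with `(t, i) ∈ A`. -/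
@[reducible] def nodeSigma (θ : Ω → Ω) (φ : Fin N → ℕ → Ω → Circ → Circ) (A : Set (ℕ × Fin N)) :
    MeasurableSpace Ω :=
  ⨆ p ∈ A, MeasurableSpace.comap (fun ω => φ p.2 1 (θ^[p.1] ω)) MeasurableSpace.pi

theorem nodeSigma_mono (θ : Ω → Ω) (φ : Fin N → ℕ → Ω → Circ → Circ) {A B : Set (ℕ × Fin N)}
    (h : A ⊆ B) : nodeSigma θ φ A ≤ nodeSigma θ φ B :=
  biSup_mono h

theorem measurable_nodeMap_nodeSigma (θ : Ω → Ω) (φ : Fin N → ℕ → Ω → Circ → Circ)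
    {A : Set (ℕ × Fin N)} {t : ℕ} {i : Fin N} (h : (t, i) ∈ A) (z : Circ) :
    Measurable[nodeSigma θ φ A] fun ω => φ i 1 (θ^[t] ω) z := by
  have h1 : Measurable[MeasurableSpace.comap (fun ω => φ i 1 (θ^[t] ω)) MeasurableSpace.pi]
      fun ω => φ i 1 (θ^[t] ω) z :=
    (measurable_pi_apply z).comp (comap_measurable _)
  exact h1.mono (le_biSup (fun p : ℕ × Fin N =>
    MeasurableSpace.comap (fun ω => φ p.2 1 (θ^[p.1] ω)) MeasurableSpace.pi) h) le_rfl

theorem nodeSigma_comap_iterate_le (θ : Ω → Ω) (φ : Fin N → ℕ → Ω → Circ → Circ)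
    (A B : Set (ℕ × Fin N)) (b : ℕ) (h : ∀ p ∈ A, (p.1 + b, p.2) ∈ B) :
    (nodeSigma θ φ A).comap (θ^[b]) ≤ nodeSigma θ φ B := by
  unfold nodeSigma
  simp only [MeasurableSpace.comap_iSup, MeasurableSpace.comap_comp]
  refine iSup₂_le fun p hp => ?_
  have : (fun ω => φ p.2 1 (θ^[p.1] ω)) ∘ θ^[b] = fun ω => φ p.2 1 (θ^[p.1 + b] ω) := by
    funext ω
    simp [Function.iterate_add_apply]
  rw [this]
  exact le_biSup (fun p : ℕ × Fin N =>
    MeasurableSpace.comap (fun ω => φ p.2 1 (θ^[p.1] ω)) MeasurableSpace.pi) (h p hp)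

theorem IsRDS.succ_apply [MeasurableSpace Ω] {θ : Ω → Ω} {φ : ℕ → Ω → Circ → Circ}
    (h : IsRDS θ φ) (t : ℕ) (ω : Ω) (x : Circ) : φ (t + 1) ω x = φ 1 (θ^[t] ω) (φ t ω x) := by
  rw [add_comm, h.cocycle]

/-- A random continuous map is jointly measurable. -/
theorem measurable_comp_of_continuous {m : MeasurableSpace Ω} {X : Type*} [MeasurableSpace X]
    {f : Ω → Circ → Circ} (hc : ∀ ω, Continuous (f ω)) (hm : ∀ z, Measurable fun ω => f ω z)
    {u : X → Ω} (hu : Measurable u) {Z : X → Circ} (hZ : Measurable Z) :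
    Measurable fun q => f (u q) (Z q) :=
  (measurable_uncurry_of_continuous_of_measurable (u := fun z ω => f ω z) hc hm).comp
    (hZ.prodMk hu)

/-- The joint measurability in `IsRDS` refers to the full `σ`-algebra on `Ω`. Measurability in the
maps actually used is obtained from continuity in the state, one step at a time. -/
theorem measurable_iterate_nodeSigma [MeasurableSpace Ω] {θ : Ω → Ω}
    {φ : Fin N → ℕ → Ω → Circ → Circ} (hφ : ∀ i, IsRDS θ (φ i))
    (hc : ∀ i ω, Continuous (φ i 1 ω)) (i : Fin N) (a r : ℕ) {A : Set (ℕ × Fin N)}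
    (hA : ∀ s, s < r → (a + s, i) ∈ A) :
    Measurable[(inferInstance : MeasurableSpace Circ).prod (nodeSigma θ φ A)]
      fun q : Circ × Ω => φ i r (θ^[a] q.2) q.1 := by
  induction r with
  | zero =>
    simp only [(hφ i).zero]
    exact @measurable_fst _ _ _ (nodeSigma θ φ A)
  | succ r ih =>
    have h := ih fun s hs => hA s (hs.trans r.lt_succ_self)
    have e : (fun q : Circ × Ω => φ i (r + 1) (θ^[a] q.2) q.1) =
        fun q => φ i 1 (θ^[a + r] q.2) (φ i r (θ^[a] q.2) q.1) := by
      funext q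
      rw [(hφ i).succ_apply, ← Function.iterate_add_apply, add_comm r a]
    rw [e]
    let _ : MeasurableSpace Ω := nodeSigma θ φ A
    exact measurable_comp_of_continuous (f := fun ω => φ i 1 (θ^[a + r] ω)) (fun ω => hc i _)
      (measurable_nodeMap_nodeSigma θ φ (hA r r.lt_succ_self)) measurable_snd h

theorem measurable_precomp_nodeSigma {θ : Ω → Ω}
    {φ : Fin N → ℕ → Ω → Circ → Circ}
    (hc : ∀ i ω, Continuous (φ i 1 ω)) (i : Fin N) (n a : ℕ) (p : Circ) {A : Set (ℕ × Fin N)}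
    (hA : ∀ s, a ≤ s → (s, i) ∈ A) :
    Measurable[nodeSigma θ φ A] fun ω => precomp θ (φ i 1) n (θ^[a] ω) p := by
  induction n generalizing a with
  | zero => exact measurable_const
  | succ n ih =>
    have h := ih (a + 1) fun s hs => hA s (by omega)
    simp only [precomp, ← Function.iterate_succ_apply' θ]
    let _ : MeasurableSpace Ω := nodeSigma θ φ A
    exact measurable_comp_of_continuous (f := fun ω => φ i 1 (θ^[a] ω)) (fun ω => hc i _)
      (measurable_nodeMap_nodeSigma θ φ (hA a le_rfl)) measurable_id h

/-- Fubini for a random map evaluated at an independent random point. -/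
theorem lintegral_comp_of_indepFun {Ω Ω' : Type*} [MeasurableSpace Ω] [MeasurableSpace Ω']
    {P : Measure Ω} [IsProbabilityMeasure P] {Z : Ω → Circ} {W : Ω → Ω'} (hZ : Measurable Z)
    (hW : Measurable W) (hI : IndepFun Z W P) {K : Circ × Ω' → ENNReal} (hK : Measurable K) :
    ∫⁻ ω, K (Z ω, W ω) ∂P = ∫⁻ z, ∫⁻ ω, K (z, W ω) ∂P ∂(P.map Z) := by
  have e := (lintegral_map hK (hZ.prodMk hW) (μ := P)).symm
  rw [hI.map_prod_eq_prod_map_map hZ.aemeasurable hW.aemeasurable,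
    lintegral_prod _ hK.aemeasurable] at e
  rw [e]
  exact lintegral_congr fun z => lintegral_map (hK.comp measurable_prodMk_left) hW

/-- The independent random element is the identity of `Ω`, with `m₂` as the `σ`-algebra of the
target. -/
theorem lintegral_comp_of_indep {Ω : Type*} {m₁ m₂ : MeasurableSpace Ω} [mΩ : MeasurableSpace Ω]
    {P : Measure Ω} [IsProbabilityMeasure P] (h₁ : m₁ ≤ mΩ) (h₂ : m₂ ≤ mΩ)
    (hI : Indep m₁ m₂ P) {Z : Ω → Circ} (hZ : Measurable[m₁] Z) {K : Circ × Ω → Circ}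
    (hK : Measurable[(inferInstance : MeasurableSpace Circ).prod m₂] K) {g : Circ → ENNReal}
    (hg : Measurable g) :
    ∫⁻ ω, g (K (Z ω, ω)) ∂P = ∫⁻ z, ∫⁻ ω, g (K (z, ω)) ∂P ∂(P.map Z) := by
  have hind : @IndepFun Ω Circ Ω _ _ m₂ Z id P := by
    refine (@IndepFun_iff_Indep _ _ _ _ _ m₂ Z id P).2 ?_
    rw [MeasurableSpace.comap_id]
    exact indep_of_indep_of_le_left hI hZ.comap_le
  exact @lintegral_comp_of_indepFun Ω Ω mΩ m₂ P _ Z id (hZ.mono h₁ le_rfl)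
    (measurable_id.mono h₂ le_rfl) hind (fun q => g (K q)) (hg.comp hK)

/-! ### Independence of disjoint blocks of node maps. -/

section Independence

variable [MeasurableSpace Ω] {P : Measure Ω} {θ : Ω → Ω} {φ : Fin N → ℕ → Ω → Circ → Circ}

theorem measurable_nodeMap (hθ : Measurable θ) (hφ : ∀ i, IsRDS θ (φ i)) (i : Fin N) (t r : ℕ) :
    Measurable fun q : Circ × Ω => φ i r (θ^[t] q.2) q.1 :=
  (hφ i).measurable.comp (measurable_const.prodMk
    (((hθ.iterate t).comp measurable_snd).prodMk measurable_fst))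

theorem measurable_nodeMap_left (hθ : Measurable θ) (hφ : ∀ i, IsRDS θ (φ i)) (i : Fin N)
    (t r : ℕ) (z : Circ) : Measurable fun ω => φ i r (θ^[t] ω) z :=
  (measurable_nodeMap hθ hφ i t r).comp (measurable_const.prodMk measurable_id)

theorem comap_nodeMap_le (hθ : Measurable θ) (hφ : ∀ i, IsRDS θ (φ i)) (p : ℕ × Fin N) :
    MeasurableSpace.comap (fun ω => φ p.2 1 (θ^[p.1] ω)) MeasurableSpace.pi ≤
      (inferInstance : MeasurableSpace Ω) :=
  (measurable_pi_iff.2 fun z => measurable_nodeMap_left hθ hφ p.2 p.1 1 z).comap_le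

theorem nodeSigma_le (hθ : Measurable θ) (hφ : ∀ i, IsRDS θ (φ i)) (A : Set (ℕ × Fin N)) :
    nodeSigma θ φ A ≤ (inferInstance : MeasurableSpace Ω) :=
  iSup₂_le fun p _ => comap_nodeMap_le hθ hφ p

theorem indep_nodeSigma (hθ : Measurable θ) (hφ : ∀ i, IsRDS θ (φ i)) (hI : IIDNodeMaps P θ φ)
    {A B : Set (ℕ × Fin N)} (h : Disjoint A B) : Indep (nodeSigma θ φ A) (nodeSigma θ φ B) P :=
  indep_iSup_of_disjoint (comap_nodeMap_le hθ hφ) ((iIndepFun_iff_iIndep _ _ _).1 hI.indep) h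

/-- Splitting off one node at a time leaves two disjoint sets of pairs (time, node), whose
`σ`-algebras are independent. -/
theorem iIndep_nodeSigma [IsProbabilityMeasure P] (hθ : Measurable θ) (hφ : ∀ i, IsRDS θ (φ i))
    (hI : IIDNodeMaps P θ φ) :
    iIndep (fun i : Fin N => nodeSigma θ φ {p | p.2 = i}) P := by
  rw [iIndep_iff]
  intro S
  induction S using Finset.induction_on with
  | empty => simp
  | insert a S ha ih =>
    intro f hf
    rw [Finset.set_biInter_insert, Finset.prod_insert ha,
      ← ih fun i hi => hf i (Finset.mem_insert_of_mem hi)]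
    have hd : Disjoint {p : ℕ × Fin N | p.2 = a} {p | p.2 ∈ S} := by
      rw [Set.disjoint_left]
      rintro p (rfl : p.2 = a) (hp : p.2 ∈ S)
      exact ha hp
    refine (Indep_iff _ _ _).1 (indep_nodeSigma hθ hφ hI hd) _ _ (hf a (Finset.mem_insert_self _ _)) ?_
    refine Finset.measurableSet_biInter (m := _) S fun i hi => ?_
    refine nodeSigma_mono θ φ ?_ _ (hf i (Finset.mem_insert_of_mem hi))
    rintro p (rfl : p.2 = i)
    exact hi

end Independence

end

section

variable {Ω : Type*} {N : ℕ}

/-! ### The coding map and the stationary measure -/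

theorem dist_le_half (x y : Circ) : dist x y ≤ 1 / 2 := by
  rw [dist_eq_norm]
  simpa using AddCircle.norm_le_half_period (1 : ℝ) one_ne_zero (x := x - y)

theorem precomp_succ_apply (θ : Ω → Ω) (f : Ω → Circ → Circ) (n : ℕ) (ω : Ω) (p : Circ) :
    precomp θ f (n + 1) ω p = precomp θ f n ω (f (θ^[n] ω) p) := by
  induction n generalizing ω with
  | zero => rfl
  | succ n ih => rw [precomp, ih (θ ω)]; rfl

theorem dist_precomp_le {θ : Ω → Ω} {f : Ω → Circ → Circ} {lam : ℝ} (hlam : 0 ≤ lam)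
    (hf : ∀ ω x y, dist (f ω x) (f ω y) ≤ lam * dist x y) (n : ℕ) (ω : Ω) (p q : Circ) :
    dist (precomp θ f n ω p) (precomp θ f n ω q) ≤ lam ^ n * dist p q := by
  induction n generalizing ω with
  | zero => simp [precomp]
  | succ n ih =>
    refine (hf _ _ _).trans ?_
    rw [pow_succ', mul_assoc]
    exact mul_le_mul_of_nonneg_left (ih (θ ω)) hlam

theorem tendsto_precomp_codingMap {θ : Ω → Ω} {f : Ω → Circ → Circ} {lam : ℝ}
    (hlam : lam ∈ Set.Ioo (0 : ℝ) 1) (hf : ∀ ω x y, dist (f ω x) (f ω y) ≤ lam * dist x y)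
    (ω : Ω) : Tendsto (fun n => precomp θ f n ω 0) atTop (𝓝 (codingMap θ f ω)) := by
  have hc : CauchySeq fun n => precomp θ f n ω 0 := by
    refine cauchySeq_of_le_geometric lam (1 / 2) hlam.2 fun n => ?_
    rw [precomp_succ_apply, mul_comm]
    exact (dist_precomp_le hlam.1.le hf n ω _ _).trans
      (mul_le_mul_of_nonneg_left (dist_le_half _ _) (pow_nonneg hlam.1.le n))
  exact tendsto_nhds_limUnder (cauchySeq_tendsto_of_complete hc)

theorem codingMap_eq {θ : Ω → Ω} {f : Ω → Circ → Circ} {lam : ℝ}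
    (hlam : lam ∈ Set.Ioo (0 : ℝ) 1) (hf : ∀ ω x y, dist (f ω x) (f ω y) ≤ lam * dist x y)
    (hc : ∀ ω, Continuous (f ω)) (ω : Ω) : codingMap θ f ω = f ω (codingMap θ f (θ ω)) :=
  tendsto_nhds_unique ((tendsto_add_atTop_iff_nat 1).2 (tendsto_precomp_codingMap hlam hf ω))
    (((hc ω).tendsto _).comp (tendsto_precomp_codingMap hlam hf (θ ω)))

theorem dist_nodeMap_le {θ : Ω → Ω} [MeasurableSpace Ω] {φ : ℕ → Ω → Circ → Circ}
    (hφ : IsRDS θ φ) {lam : ℝ} (hlam : 0 ≤ lam)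
    (hf : ∀ ω x y, dist (φ 1 ω x) (φ 1 ω y) ≤ lam * dist x y) (n : ℕ) (ω : Ω) (p q : Circ) :
    dist (φ n ω p) (φ n ω q) ≤ lam ^ n * dist p q := by
  induction n with
  | zero => rw [hφ.zero, hφ.zero, pow_zero, one_mul]
  | succ n ih =>
    rw [hφ.succ_apply n ω p, hφ.succ_apply n ω q, pow_succ', mul_assoc]
    exact (hf _ _ _).trans (mul_le_mul_of_nonneg_left ih hlam)

variable [MeasurableSpace Ω] {P : Measure Ω} {θ : Ω → Ω} {φ : Fin N → ℕ → Ω → Circ → Circ}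
  {m₀ : Measure Circ} {lam : ℝ}

/-- The event that the empirical mean of `ψ` over the isolated nodes in `S`, run for the time `r`
from `0`, deviates from its expectation: the sum deviates by more than `a`. -/
def deviationEvent (P : Measure Ω) (φ : Fin N → ℕ → Ω → Circ → Circ) (r : ℕ) (S : Finset (Fin N))
    (ψ : Circ → ℝ) (a : ℝ) : Set Ω :=
  {ω | a < |∑ j ∈ S, (ψ (φ j r ω 0) - ∫ ω', ψ (φ j r ω' 0) ∂P)|}

theorem measurableSet_deviationEvent (hφ : ∀ i, IsRDS θ (φ i)) (hI : IIDNodeMaps P θ φ) (r : ℕ)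
    (S : Finset (Fin N)) {ψ : Circ → ℝ} (hψ : Continuous ψ) (a : ℝ) :
    MeasurableSet[nodeSigma θ φ {p | p.1 < r}] (deviationEvent P φ r S ψ a) := by
  have h : ∀ j, Measurable[nodeSigma θ φ {p | p.1 < r}] fun ω => ψ (φ j r ω 0) := fun j => by
    have h1 := measurable_iterate_nodeSigma hφ hI.continuous j 0 r (A := {p | p.1 < r}) (by simp)
    let _ : MeasurableSpace Ω := nodeSigma θ φ {p | p.1 < r}
    exact hψ.measurable.comp (h1.comp measurable_prodMk_left)
  have h2 : Measurable[nodeSigma θ φ {p | p.1 < r}] fun ω =>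
      ∑ j ∈ S, (ψ (φ j r ω 0) - ∫ ω', ψ (φ j r ω' 0) ∂P) :=
    @Finset.measurable_fun_sum _ _ _ _ _ _ (nodeSigma θ φ {p | p.1 < r}) _ _
      fun j _ => (h j).sub measurable_const
  exact (measurable_norm.comp h2) measurableSet_Ioi

variable [IsProbabilityMeasure P]

/-- In `π(ω) = f_ω(π(θω))` the point `π(θω)` depends on the maps at times at least `1`, hence is
independent of `f_ω`, and it has the law of `π` because `θ` preserves `P`. -/
theorem isStationary_map_codingMap (hθ : MeasurePreserving θ P P) (hφ : ∀ i, IsRDS θ (φ i))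
    (hI : IIDNodeMaps P θ φ) (hlam : lam ∈ Set.Ioo (0 : ℝ) 1)
    (hf : ∀ i ω x y, dist (φ i 1 ω x) (φ i 1 ω y) ≤ lam * dist x y) (i : Fin N) :
    Measurable (codingMap θ (φ i 1)) ∧
      IsStationary P (φ i 1) (P.map (codingMap θ (φ i 1))) := by
  set A : Set (ℕ × Fin N) := {p | 1 ≤ p.1}
  have hcont := hI.continuous
  have hm : ∀ a : ℕ, ∀ B : Set (ℕ × Fin N), (∀ s, a ≤ s → (s, i) ∈ B) →
      Measurable[nodeSigma θ φ B] fun ω => codingMap θ (φ i 1) (θ^[a] ω) := fun a B hB => by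
    let _ : MeasurableSpace Ω := nodeSigma θ φ B
    exact measurable_of_tendsto_metrizable
      (fun n => measurable_precomp_nodeSigma hcont i n a 0 hB)
      (tendsto_pi_nhds.2 fun ω => tendsto_precomp_codingMap hlam (hf i) (θ^[a] ω))
  have hπ : Measurable (codingMap θ (φ i 1)) :=
    (hm 0 Set.univ fun _ _ => trivial).mono (nodeSigma_le hθ.measurable hφ _) le_rfl
  refine ⟨hπ, fun B hB => ?_⟩
  have hd : Disjoint A {(0, i)} := by simp [A]
  have key := lintegral_comp_of_indep (nodeSigma_le hθ.measurable hφ A)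
    (nodeSigma_le hθ.measurable hφ {(0, i)}) (indep_nodeSigma hθ.measurable hφ hI hd)
    (hm 1 A fun s hs => hs) (K := fun q : Circ × Ω => φ i 1 (θ^[0] q.2) q.1)
    (measurable_iterate_nodeSigma hφ hI.continuous i 0 1 (by simp))
    (g := B.indicator 1) (measurable_one.indicator hB)
  simp only [Function.iterate_one, Function.iterate_zero, id] at key
  have e1 : P.map (fun ω => codingMap θ (φ i 1) (θ ω)) = P.map (codingMap θ (φ i 1)) := by
    conv_rhs => rw [← hθ.map_eq]
    rw [Measure.map_map hπ hθ.measurable]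
    rfl
  have e2 : ∀ z, ∫⁻ ω, B.indicator 1 (φ i 1 ω z) ∂P = P {ω | φ i 1 ω z ∈ B} := fun z => by
    have hz : Measurable fun ω => φ i 1 ω z := measurable_nodeMap_left hθ.measurable hφ i 0 1 z
    exact lintegral_indicator_one (hz hB)
  rw [e1] at key
  simp only [e2, ← codingMap_eq hlam (hf i) (hI.continuous i)] at key
  rw [← key, Measure.map_apply hπ hB, ← lintegral_indicator_one (hπ hB)]
  rfl

theorem eq_map_codingMap (hθ : MeasurePreserving θ P P) (hφ : ∀ i, IsRDS θ (φ i))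
    (hI : IIDNodeMaps P θ φ) (hm : ∀ i, IsUniqueStationary P (φ i 1) m₀)
    (hlam : lam ∈ Set.Ioo (0 : ℝ) 1)
    (hf : ∀ i ω x y, dist (φ i 1 ω x) (φ i 1 ω y) ≤ lam * dist x y) (i : Fin N) :
    m₀ = P.map (codingMap θ (φ i 1)) := by
  obtain ⟨h1, h2⟩ := isStationary_map_codingMap hθ hφ hI hlam hf i
  exact ((hm i).2.2 _ (Measure.isProbabilityMeasure_map h1.aemeasurable) h2).symm

theorem lintegral_lintegral_of_isStationary [IsProbabilityMeasure m₀] {f : Ω → Circ → Circ}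
    (hf : Measurable fun q : Circ × Ω => f q.2 q.1) (hm : IsStationary P f m₀)
    {u : Circ → ENNReal} (hu : Measurable u) :
    ∫⁻ x, ∫⁻ ω, u (f ω x) ∂P ∂m₀ = ∫⁻ x, u x ∂m₀ := by
  have h : (m₀.prod P).map (fun q => f q.2 q.1) = m₀ := by
    ext B hB
    rw [Measure.map_apply hf hB, Measure.prod_apply (hf hB), ← hm B hB]
    rfl
  conv_rhs => rw [← h]
  rw [lintegral_map hu hf, lintegral_prod (fun q : Circ × Ω => u (f q.2 q.1)) (hu.comp hf).aemeasurable]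

/-- Stationarity over `r` steps: the map at time `0` is independent of the later ones, so one step
is integrated out at a time. -/
theorem lintegral_lintegral_nodeMap [IsProbabilityMeasure m₀] (hθ : MeasurePreserving θ P P)
    (hφ : ∀ i, IsRDS θ (φ i)) (hI : IIDNodeMaps P θ φ) {i : Fin N}
    (hm : IsStationary P (φ i 1) m₀) (r : ℕ) {u : Circ → ENNReal} (hu : Measurable u) :
    ∫⁻ x, ∫⁻ ω, u (φ i r ω x) ∂P ∂m₀ = ∫⁻ x, u x ∂m₀ := by
  have hmeas : ∀ r, Measurable fun q : Circ × Ω => φ i r q.2 q.1 := fun r =>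
    measurable_nodeMap hθ.measurable hφ i 0 r
  induction r with
  | zero => simp [(hφ i).zero]
  | succ r ih =>
    set U : Circ → ENNReal := fun z => ∫⁻ ω, u (φ i r ω z) ∂P with hU
    have hUm : Measurable U := (hu.comp (hmeas r)).lintegral_prod_right'
    rw [← ih, ← lintegral_lintegral_of_isStationary (hmeas 1) hm hUm]
    refine lintegral_congr fun x => ?_
    have hd : Disjoint {((0 : ℕ), i)} {p : ℕ × Fin N | 1 ≤ p.1} := by simp
    have hx : Measurable fun ω => φ i 1 ω x := measurable_nodeMap_left hθ.measurable hφ i 0 1 x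
    have key := lintegral_comp_of_indep (nodeSigma_le hθ.measurable hφ {(0, i)})
      (nodeSigma_le hθ.measurable hφ {p | 1 ≤ p.1}) (indep_nodeSigma hθ.measurable hφ hI hd)
      (Z := fun ω => φ i 1 (θ^[0] ω) x)
      (measurable_nodeMap_nodeSigma θ φ (Set.mem_singleton _) x)
      (K := fun q : Circ × Ω => φ i r (θ^[1] q.2) q.1)
      (measurable_iterate_nodeSigma hφ hI.continuous i 1 r (fun s _ => by simp)) hu
    simp only [Function.iterate_one, Function.iterate_zero, id] at key
    simp only [(hφ i).cocycle 1 r, Function.iterate_one]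
    rw [key, lintegral_map (Measurable.lintegral_prod_right' (f := fun q : Circ × Ω =>
      u (φ i r (θ q.2) q.1))
      (hu.comp ((hmeas r).comp (measurable_fst.prodMk (hθ.measurable.comp measurable_snd))))) hx]
    refine lintegral_congr fun ω => ?_
    exact hθ.lintegral_comp (hu.comp ((hmeas r).comp measurable_prodMk_left))

/-- By stationarity the integral against `m₀` is the mean over orbits started from `m₀`; contraction
compares each of them with the orbit from `0` under the same noise. -/
theorem norm_integral_nodeMap_sub_le [IsProbabilityMeasure m₀] (hθ : MeasurePreserving θ P P)
    (hφ : ∀ i, IsRDS θ (φ i)) (hI : IIDNodeMaps P θ φ) {i : Fin N}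
    (hm : IsStationary P (φ i 1) m₀) (hlam : 0 ≤ lam)
    (hf : ∀ i ω x y, dist (φ i 1 ω x) (φ i 1 ω y) ≤ lam * dist x y) (r : ℕ) {ψ : Circ → ℂ} {C : ℝ}
    (hψc : Continuous ψ) (hC : 0 ≤ C) (hψ : ∀ x y, ‖ψ x - ψ y‖ ≤ C * dist x y) :
    ‖∫ ω, ψ (φ i r ω 0) ∂P - ∫ z, ψ z ∂m₀‖ ≤ C * lam ^ r := by
  have hmeas : Measurable fun q : Circ × Ω => φ i r q.2 q.1 :=
    measurable_nodeMap hθ.measurable hφ i 0 r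
  have h0 : Measurable fun ω => φ i r ω 0 := hmeas.comp measurable_prodMk_left
  have hlaw : (m₀.prod P).map (fun q => φ i r q.2 q.1) = m₀ := by
    refine Measure.ext_of_lintegral _ fun u hu => ?_
    rw [lintegral_map hu hmeas, lintegral_prod (fun q : Circ × Ω => u (φ i r q.2 q.1)) (hu.comp hmeas).aemeasurable,
      lintegral_lintegral_nodeMap hθ hφ hI hm r hu]
  obtain ⟨B, hB⟩ := isCompact_univ.exists_bound_of_continuousOn (f := ψ) hψc.continuousOn
  have e1 : ∫ z, ψ z ∂m₀ = ∫ q, ψ (φ i r q.2 q.1) ∂(m₀.prod P) := by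
    conv_lhs => rw [← hlaw]
    exact integral_map hmeas.aemeasurable hψc.aestronglyMeasurable
  have e2 : ∫ ω, ψ (φ i r ω 0) ∂P = ∫ q, ψ (φ i r q.2 0) ∂(m₀.prod P) := by
    have hs : (m₀.prod P).map Prod.snd = P := by simp
    conv_lhs => rw [← hs]
    exact integral_map measurable_snd.aemeasurable
      (hψc.measurable.comp h0).aestronglyMeasurable
  rw [e1, e2, ← integral_sub]
  · refine (norm_integral_le_of_norm_le_const (C := C * lam ^ r) (ae_of_all _ fun q => ?_)).trans
      (by simp)
    refine (hψ _ _).trans (mul_le_mul_of_nonneg_left ?_ hC)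
    refine (dist_nodeMap_le (hφ i) hlam (hf i) r q.2 _ _).trans ?_
    exact mul_le_of_le_one_right (pow_nonneg hlam r) ((dist_le_half _ _).trans (by norm_num))
  · exact Integrable.of_bound (C := B) (hψc.measurable.comp (h0.comp measurable_snd)).aestronglyMeasurable
      (ae_of_all _ fun q => hB _ trivial)
  · exact Integrable.of_bound (C := B) (hψc.measurable.comp hmeas).aestronglyMeasurable
      (ae_of_all _ fun q => hB _ trivial)

/-! ### Large deviations of the isolated nodes -/

theorem iIndepFun_nodeMap (hθ : MeasurePreserving θ P P) (hφ : ∀ i, IsRDS θ (φ i))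
    (hI : IIDNodeMaps P θ φ) (r : ℕ) : iIndepFun (fun j ω => φ j r ω 0) P := by
  rw [iIndepFun_iff_iIndep]
  have h := iIndep_nodeSigma hθ.measurable hφ hI
  rw [iIndep_iff] at h ⊢
  intro S f hf
  refine h S fun j hj => ?_
  have h1 := measurable_iterate_nodeSigma hφ hI.continuous j 0 r (A := {p | p.2 = j}) (by simp)
  have h2 : Measurable[nodeSigma θ φ {p | p.2 = j}] fun ω => φ j r ω 0 := by
    let _ : MeasurableSpace Ω := nodeSigma θ φ {p | p.2 = j}
    exact h1.comp measurable_prodMk_left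
  exact h2.comap_le _ (hf j hj)

/-- Hoeffding's inequality for the isolated nodes. -/
theorem measureReal_deviationEvent_le (hθ : MeasurePreserving θ P P) (hφ : ∀ i, IsRDS θ (φ i))
    (hI : IIDNodeMaps P θ φ) (r : ℕ) (S : Finset (Fin N)) {ψ : Circ → ℝ} (hψ : Continuous ψ)
    (hψ1 : ∀ x, |ψ x| ≤ 1) {a n : ℝ} (ha : 0 ≤ a) (hS : (S.card : ℝ) ≤ n) :
    P.real (deviationEvent P φ r S ψ a) ≤ 2 * Real.exp (-(a ^ 2 / (2 * n))) := by
  rcases S.eq_empty_or_nonempty with rfl | hne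
  · have : deviationEvent P φ r ∅ ψ a = ∅ := by
      ext ω
      simp [deviationEvent, ha]
    rw [this, measureReal_empty]
    positivity
  have hpos : (0 : ℝ) < S.card := by exact_mod_cast hne.card_pos
  have hmeas : ∀ j, Measurable fun ω => ψ (φ j r ω 0) := fun j =>
    hψ.measurable.comp (measurable_nodeMap_left hθ.measurable hφ j 0 r 0)
  set X : Fin N → Ω → ℝ := fun j ω => ψ (φ j r ω 0) - ∫ ω', ψ (φ j r ω' 0) ∂P with hX
  have hind : iIndepFun X P := (iIndepFun_nodeMap hθ hφ hI r).comp
    (fun j z => ψ z - ∫ ω', ψ (φ j r ω' 0) ∂P) fun j => hψ.measurable.sub_const _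
  have hind' : iIndepFun (fun j ω => -X j ω) P := hind.comp (fun _ v => -v) fun _ => measurable_neg
  -- A variable with values in `[-1, 1]` has subgaussian parameter `(2 / 2)² = 1`.
  have hsub : ∀ j, HasSubgaussianMGF (X j) 1 P := fun j => by
    have := hasSubgaussianMGF_of_mem_Icc (a := -1) (b := 1) (hmeas j).aemeasurable
      (ae_of_all P fun ω => abs_le.1 (hψ1 _))
    convert this using 1
    ext
    norm_num
  have h1 := HasSubgaussianMGF.measure_sum_ge_le_of_iIndepFun hind (s := S) (c := fun _ => 1)
    (fun j _ => hsub j) ha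
  have h2 := HasSubgaussianMGF.measure_sum_ge_le_of_iIndepFun hind' (s := S) (c := fun _ => 1)
    (fun j _ => (hsub j).neg) ha
  have hexp : Real.exp (-a ^ 2 / (2 * ((∑ _j ∈ S, (1 : NNReal) : NNReal) : ℝ))) ≤
      Real.exp (-(a ^ 2 / (2 * n))) := by
    rw [Real.exp_le_exp, neg_div, neg_le_neg_iff]
    simp only [Finset.sum_const, nsmul_eq_mul, mul_one, NNReal.coe_natCast]
    gcongr
  have hsubset : deviationEvent P φ r S ψ a ⊆
      {ω | a ≤ ∑ j ∈ S, X j ω} ∪ {ω | a ≤ ∑ j ∈ S, -X j ω} := by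
    intro ω (hω : a < |∑ j ∈ S, X j ω|)
    rcases lt_abs.1 hω with h | h
    · exact Or.inl h.le
    · right
      simpa only [Set.mem_ofPred_eq, Finset.sum_neg_distrib] using h.le
  calc P.real (deviationEvent P φ r S ψ a) ≤ _ := measureReal_mono hsubset
    _ ≤ _ := measureReal_union_le _ _
    _ ≤ _ := add_le_add (h1.trans hexp) (h2.trans hexp)
    _ = _ := (two_mul _).symm

/-! ### Frequencies of events that depend on finitely many node maps -/

theorem sum_range_mul_eq (F : ℕ → ℝ) (m R : ℕ) :
    ∑ t ∈ Finset.range (m * R), F t =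
      ∑ a ∈ Finset.range R, ∑ n ∈ Finset.range m, F (a + n * R) := by
  rw [Finset.sum_comm]
  induction m with
  | zero => simp
  | succ m ih =>
    rw [Nat.succ_mul, Finset.sum_range_add, ih, Finset.sum_range_succ]
    simp only [add_comm]

/-- At times spaced by the window length `R` the indicators depend on disjoint blocks of node maps,
so they are pairwise independent and the strong law applies. -/
theorem ae_tendsto_sum_indicator_div (hθ : MeasurePreserving θ P P) (hφ : ∀ i, IsRDS θ (φ i))
    (hI : IIDNodeMaps P θ φ) {R : ℕ} {E : Set Ω}
    (hE : MeasurableSet[nodeSigma θ φ {p | p.1 < R}] E) (a : ℕ) :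
    ∀ᵐ ω ∂P, Tendsto (fun m : ℕ =>
      (∑ n ∈ Finset.range m, E.indicator (fun _ => (1 : ℝ)) (θ^[a + n * R] ω)) / m) atTop
        (𝓝 (P.real E)) := by
  have hE' : MeasurableSet E := nodeSigma_le hθ.measurable hφ _ _ hE
  set F : Ω → ℝ := E.indicator fun _ => (1 : ℝ) with hF
  have hFm : Measurable F := measurable_const.indicator hE'
  have hFs : Measurable[nodeSigma θ φ {p | p.1 < R}] F := measurable_const.indicator hE
  have hXm : ∀ b, Measurable[nodeSigma θ φ {p | b ≤ p.1 ∧ p.1 < b + R}] fun ω => F (θ^[b] ω) := by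
    intro b
    have h1 : Measurable[(nodeSigma θ φ {p | p.1 < R}).comap (θ^[b])] fun ω => F (θ^[b] ω) :=
      hFs.comp (comap_measurable _)
    refine h1.mono (nodeSigma_comap_iterate_le θ φ _ _ b fun p (hp : p.1 < R) => ?_) le_rfl
    constructor <;> dsimp only <;> omega
  have hmap : ∀ b, P.map (fun ω => F (θ^[b] ω)) = P.map F := fun b => by
    conv_rhs => rw [← (hθ.iterate b).map_eq]
    rw [Measure.map_map hFm (hθ.iterate b).measurable]
    rfl
  have hmm : ∀ b, Measurable fun ω => F (θ^[b] ω) := fun b => hFm.comp (hθ.iterate b).measurable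
  have hint : ∀ b, Integrable (fun ω => F (θ^[b] ω)) P := fun b =>
    Integrable.of_bound (C := 1) (hmm b).aestronglyMeasurable (ae_of_all _ fun ω => by
      by_cases h : θ^[b] ω ∈ E <;> simp [hF, h])
  have h := strong_law_ae_real (μ := P) (fun n ω => F (θ^[a + n * R] ω)) (hint _) (by
    intro n n' hnn
    have hd : Disjoint {p : ℕ × Fin N | a + n * R ≤ p.1 ∧ p.1 < a + n * R + R}
        {p | a + n' * R ≤ p.1 ∧ p.1 < a + n' * R + R} := by
      rw [Set.disjoint_left]
      rintro p ⟨h1, h2⟩ ⟨h3, h4⟩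
      rcases lt_or_gt_of_ne hnn with h | h
      · have := Nat.mul_le_mul_right R (Nat.succ_le_of_lt h)
        rw [Nat.succ_mul] at this
        omega
      · have := Nat.mul_le_mul_right R (Nat.succ_le_of_lt h)
        rw [Nat.succ_mul] at this
        omega
    refine (IndepFun_iff_Indep _ _ _).2 ?_
    exact indep_of_indep_of_le_left (indep_of_indep_of_le_right
      (indep_nodeSigma hθ.measurable hφ hI hd) (hXm _).comap_le) (hXm _).comap_le)
    (fun n => ⟨(hmm _).aemeasurable, (hmm _).aemeasurable, by rw [hmap, hmap]⟩)
  have hE1 : ∫ ω, F (θ^[a + 0 * R] ω) ∂P = P.real E := by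
    rw [← integral_map (φ := θ^[a + 0 * R]) (hθ.iterate _).measurable.aemeasurable
      hFm.aestronglyMeasurable, (hθ.iterate _).map_eq]
    exact integral_indicator_one hE'
  rw [hE1] at h
  exact h

-- The times are split into residue classes modulo the window length. Completing the last window
-- costs a bounded amount, absorbed by half of the gap `η - P(E)`.
open Classical in
theorem ae_eventually_card_le (hθ : MeasurePreserving θ P P) (hφ : ∀ i, IsRDS θ (φ i))
    (hI : IIDNodeMaps P θ φ) {r : ℕ} {E : Set Ω}
    (hE : MeasurableSet[nodeSigma θ φ {p | p.1 < r}] E) :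
    ∀ᵐ ω ∂P, ∀ η > P.real E, ∀ᶠ T : ℕ in atTop,
      (((Finset.range T).filter fun t => θ^[t] ω ∈ E).card : ℝ) ≤ η * T := by
  -- The extra unit keeps the window length positive when `r = 0`.
  set R := r + 1
  have hE' : MeasurableSet[nodeSigma θ φ {p | p.1 < R}] E :=
    nodeSigma_mono θ φ (fun p (hp : p.1 < r) => hp.trans r.lt_succ_self) _ hE
  have hae := ae_all_iff.2 fun a => ae_tendsto_sum_indicator_div hθ hφ hI hE' a
  filter_upwards [hae] with ω hω η hη
  set F : ℕ → ℝ := fun t => E.indicator (fun _ => (1 : ℝ)) (θ^[t] ω) with hF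
  have hF0 : ∀ t, 0 ≤ F t := fun t => Set.indicator_nonneg (fun _ _ => zero_le_one) _
  set p := P.real E
  have hp : 0 ≤ p := measureReal_nonneg
  have hR : (0 : ℝ) < R := by positivity
  set d := (η - p) / 2 with hd
  have hd0 : 0 < d := by rw [hd]; linarith
  have h1 : ∀ a, ∀ᶠ m : ℕ in atTop, ∑ n ∈ Finset.range m, F (a + n * R) ≤ (p + d) * m := by
    intro a
    filter_upwards [(hω a).eventually (gt_mem_nhds (show p < p + d by linarith)),
      eventually_gt_atTop 0] with m hm hm0
    exact ((div_lt_iff₀ (by exact_mod_cast hm0)).1 hm).le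
  have h2 : ∀ᶠ m : ℕ in atTop, ∀ a ∈ Finset.range R,
      ∑ n ∈ Finset.range m, F (a + n * R) ≤ (p + d) * m :=
    (Finset.eventually_all _).2 fun a _ => h1 a
  have htend : Tendsto (fun T : ℕ => T / R + 1) atTop atTop :=
    (tendsto_add_atTop_nat 1).comp (Nat.tendsto_div_const_atTop (Nat.succ_ne_zero r))
  filter_upwards [htend.eventually h2, eventually_ge_atTop ⌈R * (p + d) / d⌉₊] with T hT hT'
  have hcard : (((Finset.range T).filter fun t => θ^[t] ω ∈ E).card : ℝ) =
      ∑ t ∈ Finset.range T, F t := by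
    rw [Finset.card_filter]
    push_cast
    exact Finset.sum_congr rfl fun t _ => by simp [hF, Set.indicator_apply]
  have hTm : T ≤ (T / R + 1) * R := by
    have := Nat.lt_div_mul_add (a := T) (b := R) (Nat.succ_pos r)
    rw [Nat.succ_mul]
    exact this.le
  have hle : ((T / R + 1 : ℕ) : ℝ) ≤ T / R + 1 := by
    push_cast
    gcongr
    exact Nat.cast_div_le
  have hT'' : R * (p + d) ≤ d * T := by
    have := Nat.le_of_ceil_le hT'
    rw [div_le_iff₀ hd0] at this
    linarith
  calc _ = ∑ t ∈ Finset.range T, F t := hcard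
    _ ≤ ∑ t ∈ Finset.range ((T / R + 1) * R), F t :=
        Finset.sum_le_sum_of_subset_of_nonneg (Finset.range_subset_range.2 hTm) fun t _ _ => hF0 t
    _ = _ := sum_range_mul_eq F _ R
    _ ≤ ∑ _a ∈ Finset.range R, (p + d) * ((T / R + 1 : ℕ) : ℝ) := Finset.sum_le_sum hT
    _ = R * ((p + d) * ((T / R + 1 : ℕ) : ℝ)) := by simp
    _ ≤ R * ((p + d) * (T / R + 1)) := by gcongr
    _ = (p + d) * T + R * (p + d) := by field_simp
    _ ≤ (p + d) * T + d * T := by linarith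
    _ = η * T := by rw [hd]; ring

end

section

variable {Ω : Type*} {N : ℕ}

/-! ### Graphs and interactions -/

open Classical in
/-- The low degree neighbours of node `i`. -/
noncomputable def lowNeighbors (G : SimpleGraph (Fin N)) (δ : ℕ) (i : Fin N) : Finset (Fin N) :=
  G.neighborFinset i ∩ lowDegreeNodes G δ

theorem deg_le_largestDegree (G : SimpleGraph (Fin N)) (i : Fin N) : deg G i ≤ largestDegree G := by
  classical
  exact G.degree_le_maxDegree i

theorem card_lowNeighbors_le_deg (G : SimpleGraph (Fin N)) (δ : ℕ) (i : Fin N) :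
    (lowNeighbors G δ i).card ≤ deg G i :=
  Finset.card_le_card Finset.inter_subset_left

theorem starIndex_mul_deg (G : SimpleGraph (Fin N)) (δ : ℕ) (i : Fin N) :
    starIndex G δ i * deg G i = (lowNeighbors G δ i).card := by
  have h := card_lowNeighbors_le_deg G δ i
  refine div_mul_cancel_of_imp fun h0 => ?_
  have h0' : deg G i = 0 := by exact_mod_cast h0
  rw [h0'] at h
  exact_mod_cast Nat.le_zero.1 h

theorem starIndex_le_one (G : SimpleGraph (Fin N)) (δ : ℕ) (i : Fin N) : starIndex G δ i ≤ 1 :=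
  div_le_one_of_le₀ (by exact_mod_cast card_lowNeighbors_le_deg G δ i) (Nat.cast_nonneg _)

open Classical in
theorem interaction_eq (G : SimpleGraph (Fin N)) (α : ℝ) (h : Ω → Circ → Circ → ℝ) (ω : Ω)
    (x : Fin N → Circ) (i : Fin N) :
    interaction G α h ω x i =
      α / largestDegree G * ∑ l ∈ G.neighborFinset i, h ω (x i) (x l) := by
  unfold interaction
  rw [← Finset.sum_filter, mul_one_div, G.neighborFinset_eq_filter]

theorem abs_interaction_le (G : SimpleGraph (Fin N)) {α C : ℝ} (hα : 0 ≤ α)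
    {h : Ω → Circ → Circ → ℝ} {ω : Ω} (hC : ∀ x y, |h ω x y| ≤ C) (x : Fin N → Circ) (i : Fin N) :
    |interaction G α h ω x i| ≤ α / largestDegree G * (deg G i * C) := by
  classical
  rw [interaction_eq, abs_mul, abs_of_nonneg (by positivity)]
  gcongr
  refine (Finset.abs_sum_le_sum_abs _ _).trans ?_
  refine (Finset.sum_le_card_nsmul _ _ C fun l _ => hC _ _).trans_eq ?_
  rw [nsmul_eq_mul]
  rfl

/-- The coupling adds at most `b` per step and contraction damps the old error by `lam`; the bound
is the fixed point of `e ↦ b + lam * e`. -/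
theorem dist_networkOrbit_le [MeasurableSpace Ω] {G : SimpleGraph (Fin N)} {α C lam : ℝ}
    {θ : Ω → Ω} {φ : Fin N → ℕ → Ω → Circ → Circ} {h : Ω → Circ → Circ → ℝ} {δ : ℕ} {ω : Ω}
    (hφ : ∀ i, IsRDS θ (φ i)) (hα : 0 ≤ α) (hlam : lam ∈ Set.Ioo (0 : ℝ) 1)
    (hf : ∀ i ω x y, dist (φ i 1 ω x) (φ i 1 ω y) ≤ lam * dist x y)
    (hC : ∀ t x y, |h (θ^[t] ω) x y| ≤ C) (x : Fin N → Circ) {j : Fin N}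
    (hj : j ∈ lowDegreeNodes G δ) (t : ℕ) :
    dist (networkOrbit G α θ φ h t ω x j) (φ j t ω (x j)) ≤
      (1 - lam)⁻¹ * (α * (largestDegree G : ℝ)⁻¹ * (δ : ℝ) * C) := by
  have hC0 : 0 ≤ C := (abs_nonneg _).trans (hC 0 0 0)
  have hj' : (deg G j : ℝ) ≤ δ := by
    classical
    exact_mod_cast (Finset.mem_filter.1 hj).2
  have h1 : 0 < 1 - lam := by linarith [hlam.2]
  set b := α * (largestDegree G : ℝ)⁻¹ * (δ : ℝ) * C with hb
  have hb0 : 0 ≤ b := by positivity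
  induction t with
  | zero =>
    simp only [networkOrbit, (hφ j).zero, dist_self]
    positivity
  | succ t ih =>
    rw [(hφ j).succ_apply t ω (x j)]
    set I := interaction G α h (θ^[t] ω) (networkOrbit G α θ φ h t ω x) j with hI
    have hIb : |I| ≤ b := by
      refine (abs_interaction_le G hα (hC t) _ j).trans ?_
      rw [hb, div_eq_mul_inv, mul_assoc _ (δ : ℝ)]
      gcongr
    have hstep : dist (networkOrbit G α θ φ h (t + 1) ω x j)
        (φ j 1 (θ^[t] ω) (networkOrbit G α θ φ h t ω x j)) ≤ b := by
      change dist (φ j 1 (θ^[t] ω) (networkOrbit G α θ φ h t ω x j) + (I : Circ)) _ ≤ b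
      rw [dist_self_add_left]
      exact (UnitAddCircle.norm_eq.trans_le (by
        simpa using round_le I 0)).trans hIb
    calc _ ≤ b + lam * dist (networkOrbit G α θ φ h t ω x j) (φ j t ω (x j)) :=
          (dist_triangle _ _ _).trans (add_le_add hstep (hf _ _ _ _))
      _ ≤ b + lam * ((1 - lam)⁻¹ * b) := by
          gcongr
          exact hlam.1.le
      _ = (1 - lam)⁻¹ * b := by
          field_simp
          ring

/-- The fluctuation of a hub splits into the contribution of the neighbours of high degree, the
shadowing error of the low degree neighbours and the fluctuation of their isolated orbits. -/
theorem abs_fluctuation_le {G : SimpleGraph (Fin N)} {α C L η ν : ℝ} {h : Ω → Circ → Circ → ℝ}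
    {δ : ℕ} {ω : Ω} {m₀ : Measure Circ} (hα : 0 ≤ α) (hC : ∀ x y, |h ω x y| ≤ C)
    (hL : ∀ x y y', |h ω x y - h ω x y'| ≤ L * dist y y') (hL0 : 0 ≤ L) {i : Fin N}
    (hν : ν ≤ starIndex G δ i) {x y : Fin N → Circ}
    (hη : ∀ l ∈ lowDegreeNodes G δ, dist (x l) (y l) ≤ η) (hη0 : 0 ≤ η) :
    |fluctuation G α h (α * (starIndex G δ i * (deg G i : ℝ) / (largestDegree G : ℝ))) m₀ i ω x| ≤
      α * (1 - ν) * C + α * L * η + α / largestDegree G *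
        |∑ l ∈ lowNeighbors G δ i, (h ω (x i) (y l) - ∫ z, h ω (x i) z ∂m₀)| := by
  classical
  have hC0 : 0 ≤ C := (abs_nonneg _).trans (hC 0 0)
  set S := lowNeighbors G δ i with hS
  set B := G.neighborFinset i with hB
  have hSB : S ⊆ B := Finset.inter_subset_left
  have hSk : (S.card : ℝ) ≤ deg G i := by exact_mod_cast card_lowNeighbors_le_deg G δ i
  have hkD : (deg G i : ℝ) ≤ largestDegree G := by exact_mod_cast deg_le_largestDegree G i
  set D : ℝ := (largestDegree G : ℝ) with hD
  have hD0 : 0 ≤ D := Nat.cast_nonneg _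
  have hBk : (B.card : ℝ) = deg G i := rfl
  have hfl : fluctuation G α h (α * (starIndex G δ i * (deg G i : ℝ) / D)) m₀ i ω x =
      α / D * (∑ l ∈ B \ S, h ω (x i) (x l) + ∑ l ∈ S, (h ω (x i) (x l) - h ω (x i) (y l)) +
        ∑ l ∈ S, (h ω (x i) (y l) - ∫ z, h ω (x i) z ∂m₀)) := by
    unfold fluctuation
    rw [interaction_eq, starIndex_mul_deg, ← Finset.sum_sdiff hSB]
    simp only [Finset.sum_sub_distrib, Finset.sum_const, nsmul_eq_mul]
    ring
  have h1 : |∑ l ∈ B \ S, h ω (x i) (x l)| ≤ D * ((1 - ν) * C) := by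
    refine (Finset.abs_sum_le_sum_abs _ _).trans
      ((Finset.sum_le_card_nsmul _ _ C fun l _ => hC _ _).trans ?_)
    rw [nsmul_eq_mul, Finset.cast_card_sdiff hSB, hBk, ← mul_assoc, ← starIndex_mul_deg]
    gcongr
    have h0 : 0 ≤ 1 - ν := by linarith [starIndex_le_one G δ i]
    calc _ = (deg G i : ℝ) * (1 - starIndex G δ i) := by ring
      _ ≤ (deg G i : ℝ) * (1 - ν) := by gcongr
      _ ≤ D * (1 - ν) := by gcongr
  have h2 : |∑ l ∈ S, (h ω (x i) (x l) - h ω (x i) (y l))| ≤ D * (L * η) := by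
    refine (Finset.abs_sum_le_sum_abs _ _).trans
      ((Finset.sum_le_card_nsmul _ _ (L * η) fun l hl => ?_).trans ?_)
    · refine (hL _ _ _).trans (mul_le_mul_of_nonneg_left (hη l ?_) hL0)
      exact (Finset.mem_inter.1 hl).2
    · rw [nsmul_eq_mul]
      gcongr
      exact hSk.trans hkD
  -- Stated as an inequality because `D` may vanish here, and then `α / D = 0`.
  have hDD : ∀ a A : ℝ, |a| ≤ D * A → 0 ≤ A → α / D * |a| ≤ α * A := fun a A ha hA => by
    calc α / D * |a| ≤ α / D * (D * A) := by gcongr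
      _ = α / D * D * A := by ring
      _ ≤ α * A := by
          gcongr
          rcases hD0.eq_or_lt with h | h
          · rw [← h, mul_zero]
            exact hα
          · exact (div_mul_cancel₀ _ h.ne').le
  rw [hfl, abs_mul, abs_of_nonneg (div_nonneg hα hD0)]
  have h0 : 0 ≤ 1 - ν := by linarith [starIndex_le_one G δ i]
  have e1 := hDD _ _ h1 (mul_nonneg h0 hC0)
  have e2 := hDD _ _ h2 (mul_nonneg hL0 hη0)
  refine (mul_le_mul_of_nonneg_left (abs_add_three _ _ _) (div_nonneg hα hD0)).trans ?_
  rw [mul_add, mul_add, mul_assoc, mul_assoc]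
  gcongr

/-! ### Frequencies -/

-- A union bound for frequencies: bad times `t ≥ r` are translates of visits at `t - r`, and the
-- first `r` times have frequency zero.
open Classical in
theorem limsup_card_div_le {ι : Type*} {θ : Ω → Ω} {ω : Ω} {B : ℕ → Prop} [DecidablePred B]
    (r : ℕ) (I : Finset ι) (E : ι → Set Ω) {e : ℝ}
    (hB : ∀ t, r ≤ t → B t → ∃ k ∈ I, θ^[t - r] ω ∈ E k)
    (hE : ∀ k ∈ I, ∀ η > e, ∀ᶠ T : ℕ in atTop,
      (((Finset.range T).filter fun t => θ^[t] ω ∈ E k).card : ℝ) ≤ η * T) :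
    limsup (fun T : ℕ => (((Finset.range T).filter B).card : ℝ) / (T : ℝ)) atTop ≤ I.card * e := by
  have hsub : ∀ T : ℕ, (((Finset.range T).filter B).card : ℝ) ≤
      r + ∑ k ∈ I, (((Finset.range T).filter fun t => θ^[t] ω ∈ E k).card : ℝ) := by
    intro T
    have hs : (Finset.range T).filter B ⊆ Finset.range r ∪
        I.biUnion fun k => ((Finset.range T).filter fun t => θ^[t] ω ∈ E k).image (· + r) := by
      intro t ht
      rw [Finset.mem_filter, Finset.mem_range] at ht
      rcases lt_or_ge t r with htr | htr
      · exact Finset.mem_union_left _ (Finset.mem_range.2 htr)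
      · obtain ⟨k, hk, hkE⟩ := hB t htr ht.2
        refine Finset.mem_union_right _ (Finset.mem_biUnion.2 ⟨k, hk, Finset.mem_image.2
          ⟨t - r, Finset.mem_filter.2 ⟨Finset.mem_range.2 (by omega), hkE⟩, by omega⟩⟩)
    have h1 := (Finset.card_le_card hs).trans (Finset.card_union_le _ _)
    have h2 := h1.trans (Nat.add_le_add_left (Finset.card_biUnion_le.trans
      (Finset.sum_le_sum fun k _ => Finset.card_image_le)) _)
    rw [Finset.card_range] at h2
    exact_mod_cast h2
  refine le_of_forall_pos_le_add fun d hd => ?_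
  set c : ℝ := (I.card : ℝ) + 1 with hc
  have hc0 : 0 < c := by positivity
  have hev : ∀ᶠ T : ℕ in atTop, ∀ k ∈ I,
      (((Finset.range T).filter fun t => θ^[t] ω ∈ E k).card : ℝ) ≤ (e + d / c) * T :=
    (Finset.eventually_all _).2 fun k hk => hE k hk _ (lt_add_of_pos_right e (div_pos hd hc0))
  refine limsup_le_of_le ?_ ?_
  · exact (isBoundedUnder_of ⟨0, fun T => by positivity⟩ :
      IsBoundedUnder (· ≥ ·) atTop _).isCoboundedUnder_le
  filter_upwards [hev, eventually_ge_atTop ⌈r * c / d⌉₊, eventually_gt_atTop 0] with T hT hTr hT0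
  have hT0' : (0 : ℝ) < T := by exact_mod_cast hT0
  have hTr' : (r : ℝ) ≤ d / c * T := by
    have := Nat.le_of_ceil_le hTr
    rw [div_le_iff₀ hd] at this
    rw [div_mul_eq_mul_div, le_div_iff₀ hc0]
    linarith
  rw [div_le_iff₀ hT0']
  calc _ ≤ (r : ℝ) + ∑ k ∈ I, (((Finset.range T).filter fun t => θ^[t] ω ∈ E k).card : ℝ) := hsub T
    _ ≤ d / c * T + ∑ _k ∈ I, (e + d / c) * T := add_le_add hTr' (Finset.sum_le_sum hT)
    _ = (I.card * e + d / c * c) * T := by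
        rw [Finset.sum_const, nsmul_eq_mul, hc]
        ring
    _ = (I.card * e + d) * T := by rw [div_mul_cancel₀ _ hc0.ne']

/-! ### Fluctuations of the characters -/

/-- The real or the imaginary part of the character `z ↦ exp (2 π i k z)`. -/
noncomputable def charPart (k : ℤ) (b : Bool) (z : Circ) : ℝ :=
  if b then (fourier k z : ℂ).re else (fourier k z : ℂ).im

theorem continuous_charPart (k : ℤ) (b : Bool) : Continuous (charPart k b) := by
  cases b
  · exact Complex.continuous_im.comp (ContinuousMap.continuous (fourier k))
  · exact Complex.continuous_re.comp (ContinuousMap.continuous (fourier k))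

theorem norm_fourier_apply (k : ℤ) (z : Circ) : ‖(fourier k z : ℂ)‖ = 1 := by
  rw [fourier_apply]
  exact Circle.norm_coe _

theorem abs_charPart_le_one (k : ℤ) (b : Bool) (z : Circ) : |charPart k b z| ≤ 1 := by
  rw [← norm_fourier_apply k z]
  cases b
  · exact Complex.abs_im_le_norm _
  · exact Complex.abs_re_le_norm _

variable [MeasurableSpace Ω] {P : Measure Ω} [IsProbabilityMeasure P] {θ : Ω → Ω}
  {φ : Fin N → ℕ → Ω → Circ → Circ} {m₀ : Measure Circ} {lam : ℝ}

theorem norm_sum_fourier_sub_integral_le (hθ : MeasurePreserving θ P P)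
    (hφ : ∀ i, IsRDS θ (φ i)) (r : ℕ) (S : Finset (Fin N)) (k : ℤ) {a : ℝ} {ω : Ω}
    (h : ∀ b, ω ∉ deviationEvent P φ r S (charPart k b) a) :
    ‖∑ j ∈ S, ((fourier k (φ j r ω 0) : ℂ) - ∫ ω', (fourier k (φ j r ω' 0) : ℂ) ∂P)‖ ≤ 2 * a := by
  have hint : ∀ j, Integrable (fun ω' => (fourier k (φ j r ω' 0) : ℂ)) P := fun j =>
    Integrable.of_bound (C := 1) ((ContinuousMap.continuous (fourier k)).measurable.comp
      (measurable_nodeMap_left hθ.measurable hφ j 0 r 0)).aestronglyMeasurable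
      (ae_of_all _ fun ω' => (norm_fourier_apply k _).le)
  have hre : ∀ j, ∫ ω', (fourier k (φ j r ω' 0) : ℂ).re ∂P =
      (∫ ω', (fourier k (φ j r ω' 0) : ℂ) ∂P).re := fun j =>
    Complex.reCLM.integral_comp_comm (hint j)
  have him : ∀ j, ∫ ω', (fourier k (φ j r ω' 0) : ℂ).im ∂P =
      (∫ ω', (fourier k (φ j r ω' 0) : ℂ) ∂P).im := fun j =>
    Complex.imCLM.integral_comp_comm (hint j)
  have h1 := h true
  have h2 := h false
  simp only [deviationEvent, Set.mem_ofPred_eq, not_lt, charPart, if_true, Bool.false_eq_true, if_false, hre, him] at h1 h2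
  refine (Complex.norm_le_abs_re_add_abs_im _).trans ?_
  rw [Complex.re_sum, Complex.im_sum]
  simp only [Complex.sub_re, Complex.sub_im]
  linarith

/-- Real and imaginary parts give `2 * a`. Moving the starting point to `0` and replacing the mean
at time `r` by `m₀` each cost `2π|k| lam ^ r` per node. -/
theorem norm_sum_fourier_orbit_sub_integral_le [IsProbabilityMeasure m₀]
    (hθ : MeasurePreserving θ P P) (hφ : ∀ i, IsRDS θ (φ i)) (hI : IIDNodeMaps P θ φ)
    (hm : ∀ i, IsStationary P (φ i 1) m₀) (hlam : 0 ≤ lam)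
    (hf : ∀ i ω x y, dist (φ i 1 ω x) (φ i 1 ω y) ≤ lam * dist x y) (r : ℕ) (S : Finset (Fin N))
    (k : ℤ) {a : ℝ} {ω : Ω} (h : ∀ b, ω ∉ deviationEvent P φ r S (charPart k b) a)
    (z : Fin N → Circ) :
    ‖∑ j ∈ S, ((fourier k (φ j r ω (z j)) : ℂ) - ∫ y, (fourier k y : ℂ) ∂m₀)‖ ≤
      2 * a + S.card * (4 * Real.pi * |(k : ℝ)| * lam ^ r) := by
  have hC : 0 ≤ 2 * Real.pi * |(k : ℝ)| := by positivity
  have h1 : ∀ j, ‖(fourier k (φ j r ω (z j)) : ℂ) - fourier k (φ j r ω 0)‖ ≤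
      2 * Real.pi * |(k : ℝ)| * lam ^ r := fun j => by
    refine (fourier_sub_le k _ _).trans (mul_le_mul_of_nonneg_left ?_ hC)
    refine (dist_nodeMap_le (hφ j) hlam (hf j) r ω _ _).trans ?_
    exact mul_le_of_le_one_right (pow_nonneg hlam r) ((dist_le_half _ _).trans (by norm_num))
  have h2 : ∀ j, ‖∫ ω', (fourier k (φ j r ω' 0) : ℂ) ∂P - ∫ y, (fourier k y : ℂ) ∂m₀‖ ≤
      2 * Real.pi * |(k : ℝ)| * lam ^ r := fun j =>
    norm_integral_nodeMap_sub_le hθ hφ hI (hm j) hlam hf r (ContinuousMap.continuous _) hC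
      (fourier_sub_le k)
  have h3 := norm_sum_fourier_sub_integral_le hθ hφ r S k h
  have e : ∑ j ∈ S, ((fourier k (φ j r ω (z j)) : ℂ) - ∫ y, (fourier k y : ℂ) ∂m₀) =
      ∑ j ∈ S, ((fourier k (φ j r ω 0) : ℂ) - ∫ ω', (fourier k (φ j r ω' 0) : ℂ) ∂P) +
      ∑ j ∈ S, (((fourier k (φ j r ω (z j)) : ℂ) - fourier k (φ j r ω 0)) +
        (∫ ω', (fourier k (φ j r ω' 0) : ℂ) ∂P - ∫ y, (fourier k y : ℂ) ∂m₀)) := by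
    rw [← Finset.sum_add_distrib]
    exact Finset.sum_congr rfl fun j _ => by ring
  rw [e]
  refine (norm_add_le _ _).trans (add_le_add h3 ?_)
  refine (norm_sum_le_of_le S fun j _ => (norm_add_le _ _).trans (add_le_add (h1 j) (h2 j))).trans_eq ?_
  rw [Finset.sum_const, nsmul_eq_mul]
  ring

/-- The trivial bound on the sum, which disposes of all characters of high frequency. -/
theorem notMem_deviationEvent_of_le (r : ℕ) (S : Finset (Fin N)) {ψ : Circ → ℝ}
    (hψ : ∀ x, |ψ x| ≤ 1) {a : ℝ} (ha : 2 * S.card ≤ a) (ω : Ω) :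
    ω ∉ deviationEvent P φ r S ψ a := by
  refine not_lt.2 (le_trans ?_ ha)
  refine (Finset.abs_sum_le_sum_abs _ _).trans
    ((Finset.sum_le_card_nsmul _ _ 2 fun j _ => ?_).trans_eq (by rw [nsmul_eq_mul, mul_comm]))
  have : |∫ ω', ψ (φ j r ω' 0) ∂P| ≤ 1 := by
    have := norm_integral_le_of_norm_le_const (μ := P) (f := fun ω' => ψ (φ j r ω' 0)) (C := 1)
      (ae_of_all _ fun ω' => hψ _)
    simpa using this
  calc _ ≤ |ψ (φ j r ω 0)| + |∫ ω', ψ (φ j r ω' 0) ∂P| := abs_sub _ _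
    _ ≤ 2 := by linarith [hψ (φ j r ω 0)]

end

section

variable {Ω : Type*} {N : ℕ}

/-! ### Reduction at a hub -/

theorem abs_iteratedDeriv_right_le {g : Circ → Circ → ℝ} (hg : IsC4 g) (x : Circ) (u : ℝ) :
    |iteratedDeriv 4 (fun u : ℝ => g x (u : Circ)) u| ≤ normC4 g := by
  obtain ⟨s, rfl⟩ := QuotientAddGroup.mk_surjective x
  simpa [partialDeriv] using abs_partialDeriv_le_normC4 hg (a := 0) (b := 4) (by norm_num) s u

theorem normC4_le_supC4 {θ : Ω → Ω} {h : Ω → Circ → Circ → ℝ} {ω : Ω}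
    (hb : BddAbove (Set.range fun t : ℕ => normC4 (h (θ^[t] ω)))) (t : ℕ) :
    normC4 (h (θ^[t] ω)) ≤ supC4 θ h ω :=
  le_ciSup hb t

theorem supC4_nonneg (θ : Ω → Ω) (h : Ω → Circ → Circ → ℝ) (ω : Ω) : 0 ≤ supC4 θ h ω :=
  Real.iSup_nonneg fun _ => normC4_nonneg _

theorem normC0_le_supC0 {θ : Ω → Ω} {h : Ω → Circ → Circ → ℝ} {ω : Ω} (hC4 : ∀ ω, IsC4 (h ω))
    (hb : BddAbove (Set.range fun t : ℕ => normC4 (h (θ^[t] ω)))) (t : ℕ) :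
    normC0 (h (θ^[t] ω)) ≤ supC0 θ h ω := by
  refine le_ciSup (f := fun t : ℕ => normC0 (h (θ^[t] ω))) ⟨supC4 θ h ω, ?_⟩ t
  rintro _ ⟨s, rfl⟩
  exact (normC0_le_normC4 (hC4 _)).trans (normC4_le_supC4 hb s)

theorem lipSeminorm_le_supLip {θ : Ω → Ω} {h : Ω → Circ → Circ → ℝ} {ω : Ω}
    (hC4 : ∀ ω, IsC4 (h ω)) (hb : BddAbove (Set.range fun t : ℕ => normC4 (h (θ^[t] ω)))) (t : ℕ) :
    lipSeminorm (h (θ^[t] ω)) ≤ supLip θ h ω := by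
  refine le_ciSup (f := fun t : ℕ => lipSeminorm (h (θ^[t] ω))) ⟨2 * supC4 θ h ω, ?_⟩ t
  rintro _ ⟨s, rfl⟩
  exact (lipSeminorm_le (hC4 _)).trans
    (mul_le_mul_of_nonneg_left (normC4_le_supC4 hb s) zero_le_two)

/-- The nonzero frequencies of absolute value at most `K`. -/
noncomputable def nonzeroModes (K : ℕ) : Finset ℤ := (Finset.Icc (-(K : ℤ)) K).erase 0

theorem card_nonzeroModes (K : ℕ) : (nonzeroModes K).card = 2 * K := by
  rw [nonzeroModes, Finset.card_erase_of_mem (by simp), Int.card_Icc]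
  omega

theorem notMem_nonzeroModes {K : ℕ} {k : ℤ} (hk : k ≠ 0) (h : k ∉ nonzeroModes K) :
    (K : ℝ) + 1 ≤ |(k : ℝ)| := by
  have : (K : ℤ) + 1 ≤ |k| := by
    by_contra hlt
    refine h (Finset.mem_erase.2 ⟨hk, Finset.mem_Icc.2 (abs_le.1 ?_)⟩)
    omega
  exact_mod_cast this

variable [MeasurableSpace Ω] {P : Measure Ω} [IsProbabilityMeasure P] {θ : Ω → Ω}
  {φ : Fin N → ℕ → Ω → Circ → Circ} {m₀ : Measure Circ} {lam : ℝ}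

open Classical in
/-- Along the orbit of `ω` the deviation events of all characters have upper frequency at most their
probability. -/
def HasDeviationFrequencies (P : Measure Ω) (θ : Ω → Ω) (φ : Fin N → ℕ → Ω → Circ → Circ)
    (ω : Ω) : Prop :=
  ∀ (r : ℕ) (S : Finset (Fin N)) (k : ℤ) (b : Bool) (q : ℚ),
    ∀ η > P.real (deviationEvent P φ r S (charPart k b) q), ∀ᶠ T : ℕ in atTop,
      (((Finset.range T).filter fun t =>
        θ^[t] ω ∈ deviationEvent P φ r S (charPart k b) q).card : ℝ) ≤ η * T

/-- Rational thresholds make the family countable, so one null set serves all `G`, `h`, `x`, `α` and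
`ε`. -/
theorem ae_hasDeviationFrequencies (hθ : MeasurePreserving θ P P) (hφ : ∀ i, IsRDS θ (φ i))
    (hI : IIDNodeMaps P θ φ) : ∀ᵐ ω ∂P, HasDeviationFrequencies P θ φ ω := by
  simp only [HasDeviationFrequencies, ae_all_iff (ι := ℕ), ae_all_iff (ι := Finset (Fin N)),
    ae_all_iff (ι := ℤ), ae_all_iff (ι := Bool), ae_all_iff (ι := ℚ)]
  exact fun r S k b q => ae_eventually_card_le hθ hφ hI
    (measurableSet_deviationEvent hφ hI r S (continuous_charPart k b) q)

/-- Off the deviation events the low degree neighbours integrate smooth functions almost as `m₀`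
does. -/
theorem abs_sum_orbit_sub_integral_le [IsProbabilityMeasure m₀]
    (hθ : MeasurePreserving θ P P) (hφ : ∀ i, IsRDS θ (φ i)) (hI : IIDNodeMaps P θ φ)
    (hm : ∀ i, IsStationary P (φ i 1) m₀) (hlam : 0 ≤ lam)
    (hf : ∀ i ω x y, dist (φ i 1 ω x) (φ i 1 ω y) ≤ lam * dist x y) {r : ℕ} {S : Finset (Fin N)}
    {q : ℝ} (hq : 0 < q) (hr : 4 * Real.pi * S.card * lam ^ r ≤ q) {ω : Ω}
    (h : ∀ k ∈ nonzeroModes ⌊2 * S.card / q⌋₊, ∀ b,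
      ω ∉ deviationEvent P φ r S (charPart k b) (q * |(k : ℝ)|))
    (z : Fin N → Circ) {f : Circ → ℝ} {H : ℝ} (hfc : ContDiff ℝ 4 fun u : ℝ => f (u : Circ))
    (hH : ∀ u : ℝ, |iteratedDeriv 4 (fun u : ℝ => f (u : Circ)) u| ≤ H) :
    |∑ j ∈ S, (f (φ j r ω (z j)) - ∫ y, f y ∂m₀)| ≤ H * (3 * q) / 400 := by
  refine abs_sum_sub_integral_le S _ m₀ hfc hH fun k hk => ?_
  have hk' : ∀ b, ω ∉ deviationEvent P φ r S (charPart k b) (q * |(k : ℝ)|) := by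
    intro b
    by_cases hkK : k ∈ nonzeroModes ⌊2 * S.card / q⌋₊
    · exact h k hkK b
    -- Beyond the cut-off `2 * S.card / q` the threshold `q|k|` exceeds `2 * S.card`.
    · refine notMem_deviationEvent_of_le r S (abs_charPart_le_one k b) ?_ ω
      have h1 := (Nat.lt_floor_add_one (2 * S.card / q)).le.trans (notMem_nonzeroModes hk hkK)
      rw [div_le_iff₀ hq] at h1
      linarith
  -- The tolerance `3 * q` is `2 * q` from the two parts of the character and `q` from the choice of
  -- `r`.
  refine (norm_sum_fourier_orbit_sub_integral_le hθ hφ hI hm hlam hf r S k hk' z).trans ?_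
  have := mul_le_mul_of_nonneg_right hr (abs_nonneg (k : ℝ))
  linarith

/-- The lower bound on `q` limits the number of modes to a multiple of `αH/ε` and yields the
exponent constant `2500 / 2 = 1250`, which leaves room for `450`; `M ≥ 1` covers the prefactor. -/
theorem exp_bound_aux {n D₀ q α ε H ν Δ M : ℝ} (hα : 0 < α) (hε : 0 < ε) (hH : 0 < H)
    (hD₀ : 0 < D₀) (hn : n ≤ D₀) (hνΔ : ν * Δ ≤ D₀) (hM : 1 ≤ M)
    (hq : 50 * ε * D₀ / (α * H) ≤ q) :
    8 * (2 * n / q) * Real.exp (-(q ^ 2 / (2 * D₀))) ≤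
      4 * M * (α * ε⁻¹ * H) * Real.exp (-(ν * Δ * ε ^ 2 * (α ^ 2)⁻¹ * (450 / H ^ 2))) := by
  have hq0 : 0 < 50 * ε * D₀ / (α * H) := by positivity
  have h1 : 2 * n / q ≤ α * ε⁻¹ * H / 25 := by
    calc 2 * n / q ≤ 2 * D₀ / (50 * ε * D₀ / (α * H)) := by gcongr
      _ = α * ε⁻¹ * H / 25 := by
          field_simp
          norm_num
  have h2 : ν * Δ * ε ^ 2 * (α ^ 2)⁻¹ * (450 / H ^ 2) ≤ q ^ 2 / (2 * D₀) := by
    calc ν * Δ * ε ^ 2 * (α ^ 2)⁻¹ * (450 / H ^ 2) ≤ D₀ * ε ^ 2 * (α ^ 2)⁻¹ * (1250 / H ^ 2) := by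
          have : 0 ≤ D₀ * ε ^ 2 * (α ^ 2)⁻¹ := by positivity
          gcongr
          norm_num
      _ = (50 * ε * D₀ / (α * H)) ^ 2 / (2 * D₀) := by
          field_simp
          norm_num
      _ ≤ q ^ 2 / (2 * D₀) := by gcongr
  have h3 : 0 < α * ε⁻¹ * H := by positivity
  have h4 : 8 * (2 * n / q) ≤ 4 * M * (α * ε⁻¹ * H) := by nlinarith
  gcongr

/-- The budget `ε` is split into `ε / 4` for the shadowing error and `3ε / 4` for the fluctuation of
the isolated orbits. -/
theorem admitsReduction_of_hasDeviationFrequencies [IsProbabilityMeasure m₀]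
    {G : SimpleGraph (Fin N)} {Δ δ : ℕ} {ν α ε : ℝ} {h : Ω → Circ → Circ → ℝ} {ω : Ω}
    (hθ : MeasurePreserving θ P P) (hφ : ∀ i, IsRDS θ (φ i)) (hI : IIDNodeMaps P θ φ)
    (hm : ∀ i, IsStationary P (φ i 1) m₀) (hlam : lam ∈ Set.Ioo (0 : ℝ) 1)
    (hf : ∀ i ω x y, dist (φ i 1 ω x) (φ i 1 ω y) ≤ lam * dist x y)
    (hC4 : ∀ ω, IsC4 (h ω)) (hω : HasDeviationFrequencies P θ φ ω)
    (hb : BddAbove (Set.range fun t : ℕ => normC4 (h (θ^[t] ω)))) (hΔ : 0 < Δ) (hα : 0 < α)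
    (hε : 0 < ε)
    (hε' : 4 * α ^ 2 * (δ : ℝ) * (largestDegree G : ℝ)⁻¹ * (1 - lam)⁻¹ *
      supC0 θ h ω * supLip θ h ω ≤ ε) (x : Fin N → Circ) {i : Fin N} (hi : i ∈ hubs G Δ)
    (hν : ν ≤ starIndex G δ i) :
    AdmitsReduction G α θ φ h
      (α * (starIndex G δ i * (deg G i : ℝ) / (largestDegree G : ℝ))) m₀ i ω x
      (ε + α * (1 - ν) * supC0 θ h ω)
      (4 * ((hubs G Δ).card : ℝ) * (α * ε⁻¹ * supC4 θ h ω) *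
        Real.exp (-(ν * (Δ : ℝ) * ε ^ 2 * (α ^ 2)⁻¹ * (450 / supC4 θ h ω ^ 2)))) := by
  classical
  set C := supC0 θ h ω
  set L := supLip θ h ω
  set H := supC4 θ h ω with hHdef
  have hH0 : 0 ≤ H := supC4_nonneg θ h ω
  have hC : ∀ t x y, |h (θ^[t] ω) x y| ≤ C := fun t x y =>
    (abs_le_normC0 (hC4 _) x y).trans (normC0_le_supC0 hC4 hb t)
  have hC0 : 0 ≤ C := (abs_nonneg _).trans (hC 0 0 0)
  have hL : ∀ t x y y', |h (θ^[t] ω) x y - h (θ^[t] ω) x y'| ≤ L * dist y y' := fun t x y y' =>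
    (abs_sub_le_lipSeminorm_mul_dist (hC4 _) x y y').trans
      (mul_le_mul_of_nonneg_right (lipSeminorm_le_supLip hC4 hb t) dist_nonneg)
  have hL0 : 0 ≤ L := (lipSeminorm_nonneg _).trans (lipSeminorm_le_supLip hC4 hb 0)
  have hν1 : 0 ≤ 1 - ν := by linarith [starIndex_le_one G δ i]
  have hlam1 : 0 < 1 - lam := by linarith [hlam.2]
  have hΔi : Δ ≤ deg G i := (Finset.mem_filter.1 hi).2
  have hΔD : (Δ : ℝ) ≤ largestDegree G := by
    exact_mod_cast hΔi.trans (deg_le_largestDegree G i)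
  set S := lowNeighbors G δ i with hS
  have hSD : (S.card : ℝ) ≤ largestDegree G := by
    exact_mod_cast (card_lowNeighbors_le_deg G δ i).trans (deg_le_largestDegree G i)
  set D₀ : ℝ := (largestDegree G : ℝ) with hD₀
  have hD₀pos : 0 < D₀ := lt_of_lt_of_le (by exact_mod_cast hΔ) hΔD
  set a : ℝ := α * (starIndex G δ i * (deg G i : ℝ) / D₀)
  -- If `H = 0` the coupling vanishes along the orbit and the prefactor is `0`, so the value of `450
  -- / 0` is immaterial.
  rcases hH0.eq_or_lt with hH | hH
  · have hzero : ∀ t y z, h (θ^[t] ω) y z = 0 := fun t y z => abs_nonpos_iff.1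
      ((abs_le_normC4 (hC4 _) y z).trans ((normC4_le_supC4 hb t).trans_eq hH.symm))
    have hfl : ∀ t x, fluctuation G α h a m₀ i (θ^[t] ω) x = 0 := fun t x => by
      simp [fluctuation, interaction, hzero]
    have hnn : 0 ≤ ε + α * (1 - ν) * C := by positivity
    simp [AdmitsReduction, hfl, hnn.not_gt, ← hH]
  -- The lower end feeds the probability bound, the upper end makes the Fourier error `H * (3 * q) /
  -- 400` at most `3/4 * ε * D₀ / α`.
  obtain ⟨q, hq1, hq2⟩ := exists_rat_btwn
    (show 50 * ε * D₀ / (α * H) < 100 * ε * D₀ / (α * H) by gcongr; norm_num)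
  have hq0 : (0 : ℝ) < q := lt_of_le_of_lt (by positivity) hq1
  -- The memory length `r` makes the dependence on starting points at most `q`; the `+ 1` allows `S`
  -- to be empty.
  obtain ⟨r, hr⟩ := exists_pow_lt_of_lt_one
    (show 0 < (q : ℝ) / (4 * Real.pi * S.card + 1) by positivity) hlam.2
  have hr' : 4 * Real.pi * S.card * lam ^ r ≤ q := by
    rw [lt_div_iff₀ (by positivity)] at hr
    nlinarith [pow_pos hlam.1 r]
  set K := ⌊2 * (S.card : ℝ) / q⌋₊ with hK
  set E : ℤ × Bool → Set Ω := fun p =>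
    deviationEvent P φ r S (charPart p.1 p.2) (q * |(p.1 : ℝ)|) with hE
  have hfreq := limsup_card_div_le (θ := θ) (ω := ω)
    (B := fun t => ε + α * (1 - ν) * C <
      |fluctuation G α h a m₀ i (θ^[t] ω) (networkOrbit G α θ φ h t ω x)|)
    r (nonzeroModes K ×ˢ Finset.univ) E (e := 2 * Real.exp (-((q : ℝ) ^ 2 / (2 * D₀)))) ?_ ?_
  · refine hfreq.trans (le_trans ?_ (exp_bound_aux hα hε hH hD₀pos hSD
      (ν := ν) (Δ := Δ) ?_ (M := (hubs G Δ).card) ?_ hq1.le))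
    -- The factor `8 * K` is `2 * K` modes, two parts of each, and the `2` of Hoeffding.
    · rw [Finset.card_product, card_nonzeroModes, Finset.card_univ, Fintype.card_bool]
      have hKle : (K : ℝ) ≤ 2 * S.card / q := Nat.floor_le (by positivity)
      push_cast
      rw [show (2 : ℝ) * K * 2 * (2 * Real.exp (-((q : ℝ) ^ 2 / (2 * D₀)))) =
        8 * K * Real.exp (-((q : ℝ) ^ 2 / (2 * D₀))) by ring]
      gcongr
    · refine le_trans ?_ hΔD
      exact mul_le_of_le_one_left (Nat.cast_nonneg _) (by linarith)
    · exact_mod_cast Finset.card_pos.2 ⟨i, hi⟩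
  · intro t hrt hbad
    by_contra! hgood
    have hsum := abs_sum_orbit_sub_integral_le hθ hφ hI hm hlam.1.le hf hq0 hr'
      (fun k hk b => hgood (k, b) (Finset.mem_product.2 ⟨hk, Finset.mem_univ _⟩))
      (fun j => φ j (t - r) ω (x j))
      (contDiff_right (hC4 (θ^[t] ω)) (networkOrbit G α θ φ h t ω x i))
      (fun u => (abs_iteratedDeriv_right_le (hC4 _) _ u).trans (normC4_le_supC4 hb t))
    have hcoc : ∀ j, φ j r (θ^[t - r] ω) (φ j (t - r) ω (x j)) = φ j t ω (x j) := fun j => by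
      rw [← (hφ j).cocycle, Nat.add_sub_cancel' hrt]
    simp only [hcoc] at hsum
    refine hbad.not_ge ((abs_fluctuation_le hα.le (hC t) (hL t) hL0 hν
      (fun l hl => dist_networkOrbit_le hφ hα.le hlam hf hC x hl t) (by positivity)).trans ?_)
    have e1 : α * L * ((1 - lam)⁻¹ * (α * D₀⁻¹ * δ * C)) ≤ ε / 4 := by
      have : 4 * (α * L * ((1 - lam)⁻¹ * (α * D₀⁻¹ * δ * C))) =
        4 * α ^ 2 * δ * D₀⁻¹ * (1 - lam)⁻¹ * C * L := by ring
      linarith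
    have e2 : H * (3 * q) / 400 ≤ 3 / 4 * ε * D₀ / α := by
      rw [lt_div_iff₀ (by positivity)] at hq2
      rw [le_div_iff₀ hα]
      nlinarith
    have e3 := mul_le_mul_of_nonneg_left (hsum.trans e2) (show 0 ≤ α / D₀ by positivity)
    have e4 : α / D₀ * (3 / 4 * ε * D₀ / α) = 3 / 4 * ε := by field_simp
    rw [e4] at e3
    linarith
  · rintro ⟨k, b⟩ hk η hη
    have hk0 : k ≠ 0 := (Finset.mem_erase.1 (Finset.mem_product.1 hk).1).1
    have hk1 : (1 : ℝ) ≤ |(k : ℝ)| := by exact_mod_cast Int.one_le_abs hk0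
    -- The threshold `q|k|` is again rational; as `|k| ≥ 1`, its Hoeffding bound is at most the one
    -- for `q`.
    have := hω r S k b (q * |(k : ℚ)|) η
    push_cast at this
    refine this (lt_of_le_of_lt ?_ hη)
    refine (measureReal_deviationEvent_le hθ hφ hI r S (continuous_charPart k b)
      (abs_charPart_le_one k b) (by positivity) hSD).trans ?_
    gcongr
    nlinarith

end

end HubReduction

/-! ### The main theorem. -/

theorem mainTheorem9 :
    ∃ (c₁ c₂ : ℝ) (D : ℝ → ℝ → ℝ → ℝ), 0 < c₁ ∧ c₁ ≤ c₂ ∧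
      (∀ α ε H : ℝ, 0 < α → 0 < ε → 0 ≤ H →
        c₁ * (α * ε⁻¹ * H) ≤ D α ε H ∧ D α ε H ≤ c₂ * (α * ε⁻¹ * H)) ∧
      ∀ (β lamHub lamLdn : ℝ) (m w : ℕ → ℝ) (Δ δ : ℕ → ℕ),
        PowerLawRegime β lamHub lamLdn m w Δ δ →
      ∀ N : ℕ, ∀ᵐ G ∂(chungLuLaw β N (m N) (w N)),
      ∀ ν : ℝ, IsLocallyStarLike G (Δ N) (δ N) ν →
      ∀ (Ω : Type*) [MeasurableSpace Ω] (P : Measure Ω) [IsProbabilityMeasure P] (θ : Ω → Ω)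
        (φ : Fin N → ℕ → Ω → Circ → Circ) (h : Ω → Circ → Circ → ℝ) (m₀ : Measure Circ)
        (α lam : ℝ),
        MeasurePreserving θ P P →
        (∀ i, IsRDS θ (φ i)) →
        IIDNodeMaps P θ φ →
        (∀ i, IsUniqueStationary P (φ i 1) m₀) →
        IIDCoupling P θ h →
        0 < α → lam ∈ Set.Ioo (0 : ℝ) 1 →
        (∀ i ω x y, dist (φ i 1 ω x) (φ i 1 ω y) ≤ lam * dist x y) →
      (∀ i, m₀ = P.map (codingMap θ (φ i 1))) ∧
      ∀ᵐ ω ∂P, BddAbove (Set.range fun t : ℕ => normC4 (h (θ^[t] ω))) →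
      ∀ x : Fin N → Circ,
        (∀ j ∈ lowDegreeNodes G (δ N), ∀ t : ℕ,
          dist (networkOrbit G α θ φ h t ω x j) (φ j t ω (x j)) ≤
            (1 - lam)⁻¹ * (α * (largestDegree G : ℝ)⁻¹ * (δ N : ℝ) * supC0 θ h ω)) ∧
        ∀ ε : ℝ,
          max (α * (Δ N : ℝ) ^ (-(1 / 2) : ℝ))
            (4 * α ^ 2 * (δ N : ℝ) * (largestDegree G : ℝ)⁻¹ * (1 - lam)⁻¹ *
              supC0 θ h ω * supLip θ h ω) ≤ ε →
          ∀ i ∈ hubs G (Δ N),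
            AdmitsReduction G α θ φ h
              (α * (starIndex G (δ N) i * (deg G i : ℝ) / (largestDegree G : ℝ))) m₀ i ω x
              (ε + α * (1 - ν) * supC0 θ h ω)
              (4 * ((hubs G (Δ N)).card : ℝ) * D α ε (supC4 θ h ω) *
                Real.exp (-(ν * (Δ N : ℝ) * ε ^ 2 * (α ^ 2)⁻¹ * (450 / supC4 θ h ω ^ 2)))) := by
  -- The mode count allows `D` to be exactly `αH/ε`.
  refine ⟨1, 1, fun α ε H => α * ε⁻¹ * H, one_pos, le_rfl, fun α ε H _ _ _ => by simp, ?_⟩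
  intro β lamHub lamLdn m w Δ δ hreg N
  refine ae_of_all _ fun G ν hstar Ω _ P _ θ φ h m₀ α lam hθ hφ hI hm hh hα hlam hf => ?_
  refine ⟨eq_map_codingMap hθ hφ hI hm hlam hf, ?_⟩
  filter_upwards [ae_hasDeviationFrequencies hθ hφ hI] with ω hω hb x
  refine ⟨fun j hj t => dist_networkOrbit_le hφ hα.le hlam hf (fun t x y =>
    (abs_le_normC0 (hh.isC4 _) x y).trans (normC0_le_supC0 hh.isC4 hb t)) x hj t,
    fun ε hε i hi => ?_⟩
  have hΔ := hreg.hubScale_pos N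
  have hΔ' : (0 : ℝ) < Δ N := by exact_mod_cast hΔ
  have : IsProbabilityMeasure m₀ := (hm i).1
  -- The bound `α Δ^(-1/2) ≤ ε` enters through the positivity of `ε`.
  exact admitsReduction_of_hasDeviationFrequencies hθ hφ hI (fun i => (hm i).2.1) hlam hf hh.isC4 hω
    hb hΔ hα (lt_of_lt_of_le (by positivity) ((le_max_left _ _).trans hε))
    ((le_max_right _ _).trans hε) x hi (hstar i hi)
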